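/- Let $p \in \mathbb{C}[z]$ be a nonconstant polynomial with only simple zeros, let $D_p = \{(x,y,z) \in \mathbb{C}^3 : xy = p(z)\}$ be the corresponding Danielewski surface with the complex structure induced from $\mathbb{C}^3$, let $\pi : D_p \to \mathbb{C}^2$, $\pi(x,y,z) = (x+y, z)$, and let $\tau = \log|\pi| : D_p \to [-\infty,\infty)$, where $|\cdot|$ is the Euclidean norm on $\mathbb{C}^2$. With $d = \partial + \bar\partial$ and $d^c = \frac{i}{4\pi}(\bar\partial - \partial)$, put $\eta = d^c\tau \wedge dd^c\tau$. For a holomorphic function $f : D_p \to \mathbb{C}$ and $r > 0$, the Griffiths–King characteristic is $$T_0(f,r) = \int_{\{\tau = \log r\}} \log^+\!\left(|f|^2\right)\, \eta ,$$ where $\{\tau = \log r\} = \pi^{-1}(rS^3)$ is oriented so that $\eta$ is positive, and the characteristic in the Ahern–Rudin normalisation is $T(f,r)$, defined by $r^3\, T(f,r) = T_0(f,r)$. Let $f : D_p \to \mathbb{C}$ be a nonconstant holomorphic function and let $g : \mathbb{C} \to \mathbb{C}$ be a transcendental entire function (an entire function that is not a polynomial). Then $$\lim_{r\to\infty} \frac{T_0(g\circ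 f, r)}{T_0(f,r)} = \lim_{r\to\infty} \frac{T(g\circ f, r)}{T(f,r)} = \infty .$$ -/

import Mathlib

noncomputable section

namespace Danielewski

/-- The Danielewski surface `{(x, y, z) ∈ ℂ³ : x * y = p z}`. -/
def surface (p : Polynomial ℂ) : Set (ℂ × ℂ × ℂ) :=
  {q | q.1 * q.2.1 = p.eval q.2.2}

/-- A function on the surface is holomorphic, for the complex structure induced from `ℂ³`, if near
every point of the surface it is the restriction of a holomorphic function on an open subset
of `ℂ³`. -/
def IsHolomorphic {p : Polynomial ℂ} (f : surface p → ℂ) : Prop :=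
  ∀ q : surface p, ∃ (U : Set (ℂ × ℂ × ℂ)) (F : ℂ × ℂ × ℂ → ℂ),
    IsOpen U ∧ (q : ℂ × ℂ × ℂ) ∈ U ∧ DifferentiableOn ℂ F U ∧
      ∀ s : surface p, (s : ℂ × ℂ × ℂ) ∈ U → f s = F s

/-- A transcendental entire function: entire and not a polynomial. -/
def IsTranscendentalEntire (g : ℂ → ℂ) : Prop :=
  Differentiable ℂ g ∧ ¬ ∃ q : Polynomial ℂ, ∀ w, g w = q.eval w

/-- The projection `π (x, y, z) = (x + y, z)`. -/
def proj (q : ℂ × ℂ × ℂ) : ℂ × ℂ := (q.1 + q.2.1, q.2.2)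

/-- The exhaustion function `τ = log |π|`, with the Euclidean norm on `ℂ²`. It is written on the
ambient space `ℂ³`. Since `d` and `dᶜ` commute with restriction to complex submanifolds, the forms
derived from `τ` on the surface are the restrictions of those derived from `τ` on `ℂ³`. -/
def tau (q : ℂ × ℂ × ℂ) : ℝ :=
  Real.log (Real.sqrt (‖(proj q).1‖ ^ 2 + ‖(proj q).2‖ ^ 2))

/-- The operator `dᶜ = (i / 4π) (∂̄ - ∂)` on real functions. As
`∂u (v) = (du (v) - i du (i v)) / 2` and `∂̄u (v) = (du (v) + i du (i v)) / 2`, this is the real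
one-form `v ↦ - du (i v) / 4π`. -/
def dc (u : ℂ × ℂ × ℂ → ℝ) (q : ℂ × ℂ × ℂ) : (ℂ × ℂ × ℂ) →L[ℝ] ℝ :=
  -(1 / (4 * Real.pi)) •
    (fderiv ℝ u q).comp (Complex.I • ContinuousLinearMap.id ℝ (ℂ × ℂ × ℂ))

/-- The exterior derivative of a one-form, `(dω) (v, w) = D_v (ω (w)) - D_w (ω (v))`. -/
def extD (ω : ℂ × ℂ × ℂ → (ℂ × ℂ × ℂ) →L[ℝ] ℝ) (q v w : ℂ × ℂ × ℂ) : ℝ :=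
  fderiv ℝ ω q v w - fderiv ℝ ω q w v

/-- The Levi form `ψ = d dᶜ τ`. -/
def levi : ℂ × ℂ × ℂ → ℂ × ℂ × ℂ → ℂ × ℂ × ℂ → ℝ := extD (dc tau)

/-- The three-form `η = dᶜ τ ∧ ψ` at the point `q`, evaluated on the vectors `v₁, v₂, v₃`. -/
def eta (q v₁ v₂ v₃ : ℂ × ℂ × ℂ) : ℝ :=
  dc tau q v₁ * levi q v₂ v₃ - dc tau q v₂ * levi q v₁ v₃ + dc tau q v₃ * levi q v₁ v₂

/-- The two sheets of `π` over `ℂ²`, labelled by a sign: `(x, y, z)` lies over `(a, b)` on the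
surface exactly if `z = b` and `{x, y} = {a / 2 ± √(a² / 4 - p b)}`. Each sheet is holomorphic off
the set of `(a, b)` with `a² / 4 - p b ∈ (-∞, 0]`. -/
def sheet (p : Polynomial ℂ) (ε : ℤˣ) (w : ℂ × ℂ) : ℂ × ℂ × ℂ :=
  (w.1 / 2 + ((ε : ℤ) : ℂ) * (w.1 ^ 2 / 4 - p.eval w.2) ^ (1 / 2 : ℂ),
   w.1 / 2 - ((ε : ℤ) : ℂ) * (w.1 ^ 2 / 4 - p.eval w.2) ^ (1 / 2 : ℂ),
   w.2)

theorem sheet_mem (p : Polynomial ℂ) (ε : ℤˣ) (w : ℂ × ℂ) : sheet p ε w ∈ surface p := by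
  have hs : ((w.1 ^ 2 / 4 - p.eval w.2) ^ (1 / 2 : ℂ)) ^ 2 = w.1 ^ 2 / 4 - p.eval w.2 := by
    rw [← Complex.cpow_nat_mul]
    norm_num
  have he : (((ε : ℤ) : ℂ)) ^ 2 = 1 := by
    rcases Int.units_eq_one_or ε with h | h <;> simp [h]
  simp only [surface, sheet, Set.mem_ofPred_eq]
  linear_combination (-((w.1 ^ 2 / 4 - p.eval w.2) ^ (1 / 2 : ℂ)) ^ 2) * he - hs

/-- Hopf coordinates `(t, α, β)` on the sphere `r S³` in `ℂ²`. -/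
def hopf (r : ℝ) (u : ℝ × ℝ × ℝ) : ℂ × ℂ :=
  (((r * Real.sin u.1 : ℝ) : ℂ) * Complex.exp ((u.2.1 : ℂ) * Complex.I),
   ((r * Real.cos u.1 : ℝ) : ℂ) * Complex.exp ((u.2.2 : ℂ) * Complex.I))

/-- The domain of the Hopf coordinates, `(0, π/2) × (0, 2π) × (0, 2π)`, on which they are a
diffeomorphism onto the complement of a null set in `r S³`. -/
def hopfBox : Set (ℝ × ℝ × ℝ) :=
  Set.Ioo 0 (Real.pi / 2) ×ˢ Set.Ioo 0 (2 * Real.pi) ×ˢ Set.Ioo 0 (2 * Real.pi)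

/-- Parametrization of one sheet of the boundary `{τ = log r} = π⁻¹ (r S³)` of the sublevel set
`{exp τ ≤ r}` of the surface. The two of them cover this boundary up to a null set. -/
def param (p : Polynomial ℂ) (ε : ℤˣ) (r : ℝ) (u : ℝ × ℝ × ℝ) : ℂ × ℂ × ℂ :=
  sheet p ε (hopf r u)

/-- The pullback of `η` under the parametrization, as a density with respect to `dt dα dβ`. -/
def etaDensity (p : Polynomial ℂ) (ε : ℤˣ) (r : ℝ) (u : ℝ × ℝ × ℝ) : ℝ :=
  eta (param p ε r u)
    (fderiv ℝ (param p ε r) u (1, 0, 0))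
    (fderiv ℝ (param p ε r) u (0, 1, 0))
    (fderiv ℝ (param p ε r) u (0, 0, 1))

/-- The integral `∫ h η` of a function against the three-form `η` over `{τ = log r}` on the
surface, oriented so that `η` is positive. -/
def boundaryIntegral {p : Polynomial ℂ} (h : surface p → ℝ) (r : ℝ) : ℝ :=
  ∑ ε : ℤˣ, ∫ u in hopfBox, h ⟨param p ε r u, sheet_mem p ε (hopf r u)⟩ * etaDensity p ε r u

/-- The Griffiths–King characteristic `T₀ (f, r)` of a holomorphic function `f` on the surface. As
`f` has no poles, it consists of the proximity term `∫ log⁺ |f|² η` only. -/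
def charGK {p : Polynomial ℂ} (f : surface p → ℂ) (r : ℝ) : ℝ :=
  boundaryIntegral (fun q => Real.posLog (‖f q‖ ^ 2)) r

/-- The characteristic `T (f, r)` in the Ahern–Rudin normalization, given by
`r ^ 3 * T (f, r) = T₀ (f, r)`. -/
def charAR {p : Polynomial ℂ} (f : surface p → ℂ) (r : ℝ) : ℝ :=
  charGK f r / r ^ 3

end Danielewski

end

/-!
Over a point `w` of `ℂ²` the surface has two points, the two solutions of a quadratic equation, and
in Hopf coordinates `η` pulls back on each sheet to the rotation-invariant density
`sin t cos t / (8 π²)`, away from the null set where the chosen square root jumps. So `T₀ (f, r)` is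
an integral over `r S³` of the function `w ↦ ∑ log⁺ |f|²`, summed over the two points above `w`.
Such fibre sums are continuous on `ℂ²`, and they are subharmonic on complex lines through the
origin: after a substitution `l + ζ ^ 2` the two points become holomorphic functions of `ζ`.
Averaging over these lines reduces all statements about spheres to statements about circles.

*Comparison of `g ∘ f` with `f`.* For every `K` there is a continuous subharmonic function `h` on
`ℂ` with `log⁺ |g| ≥ K log⁺ |w| + h` (`IsTranscendentalEntire.exists_minorant`). Away from the
origin `log⁺ |g| - K log |w|` is subharmonic; it is glued near the origin to a harmonic function
that nearly agrees with it on a large circle `|w| = R`. The gluing works because by Harnack's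
inequality that harmonic function exceeds `log⁺ |g|` on the unit circle, its mean value, which is
essentially the characteristic of `g` at `R`, being far larger than `log R`. Composing with `f`
and using the mean value inequality for `h ∘ f` gives `T₀ (g ∘ f, r) ≥ K T₀ (f, r) - C`
(`exists_mul_charGK_sub_le`).

*Growth of `T₀ (f, r)`.* If `T₀ (f, ·)` were bounded along a sequence of radii tending to infinity,
then by Fatou's lemma the circular means on almost every complex line through the origin would be
bounded along a subsequence. By Harnack's inequality `f` would be bounded on the part of the surface
above such a line, hence for every `c` the product of `f - c` over the fibres, which is entire on
the line, would be constant by Liouville's theorem. By density it would be constant on `ℂ²`. For a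
value `c` that `f` takes, but not at a given branch point, it vanishes somewhere and is nonzero
below the branch point, a contradiction (`tendsto_charGK_atTop`).
-/

noncomputable section

namespace Danielewski

open Filter Topology Metric Real MeasureTheory

/-! ### Harmonic approximation on a circle and Harnack's inequality -/

/-- A continuous function on a circle is uniformly close to the real part of an entire function,
since the trigonometric polynomials are dense. -/
theorem exists_differentiable_re_approx {v : ℂ → ℝ} (hv : Continuous v) {R : ℝ} (hR : 0 < R)
    {ε : ℝ} (hε : 0 < ε) :
    ∃ Q : ℂ → ℂ, Differentiable ℂ Q ∧ ∀ z ∈ sphere (0 : ℂ) R, |v z - (Q z).re| < ε := by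
  have : Fact (0 < 2 * π) := ⟨by positivity⟩
  let F : C(AddCircle (2 * π), ℂ) :=
    ⟨fun x => (v (R * (AddCircle.toCircle x : ℂ)) : ℂ), by fun_prop⟩
  -- The functions `A + conj B` with `A`, `B` boundary values of entire functions form a complex
  -- subspace. It contains all `exp (i n x)`, and there `re (A + conj B) = re (A + B)`.
  let V : Submodule ℂ C(AddCircle (2 * π), ℂ) :=
    { carrier := {G | ∃ A B : ℂ → ℂ, Differentiable ℂ A ∧ Differentiable ℂ B ∧
        ∀ x, G x = A (AddCircle.toCircle x) + star (B (AddCircle.toCircle x))}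
      add_mem' := by
        rintro G G' ⟨A, B, hA, hB, h⟩ ⟨A', B', hA', hB', h'⟩
        refine ⟨A + A', B + B', hA.add hA', hB.add hB', fun x => ?_⟩
        simp only [ContinuousMap.add_apply, h, h', Pi.add_apply, star_add]
        ring
      zero_mem' := ⟨0, 0, by fun_prop, by fun_prop, fun x => by simp⟩
      smul_mem' := by
        rintro c G ⟨A, B, hA, hB, h⟩
        refine ⟨fun z => c * A z, fun z => star c * B z, hA.const_mul _, hB.const_mul _,
          fun x => ?_⟩
        simp [h, mul_add] }
  have hV : Submodule.span ℂ (Set.range (@fourier (2 * π))) ≤ V := by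
    rw [Submodule.span_le]
    rintro _ ⟨n, rfl⟩
    rcases Int.eq_nat_or_neg n with ⟨m, rfl | rfl⟩
    · refine ⟨fun z => z ^ m, 0, by fun_prop, by fun_prop, fun x => ?_⟩
      simp [fourier_apply, AddCircle.toCircle_nsmul]
    · refine ⟨0, fun z => z ^ m, by fun_prop, by fun_prop, fun x => ?_⟩
      rw [fourier_neg]
      simp [fourier_apply, AddCircle.toCircle_nsmul]
  have hF : F ∈ (Submodule.span ℂ (Set.range (@fourier (2 * π)))).topologicalClosure := by
    rw [span_fourier_closure_eq_top]; trivial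
  obtain ⟨G, hG, hGF⟩ := Metric.mem_closure_iff.1 hF ε hε
  obtain ⟨A, B, hA, hB, hAB⟩ := hV hG
  refine ⟨fun z => A ((R : ℂ)⁻¹ * z) + B ((R : ℂ)⁻¹ * z), by fun_prop, fun z hz => ?_⟩
  have hz' : ‖(R : ℂ)⁻¹ * z‖ = 1 := by
    rw [mem_sphere_zero_iff_norm] at hz
    simp [hz, abs_of_pos hR, hR.ne']
  obtain ⟨x, hx'⟩ : ∃ x : AddCircle (2 * π), (AddCircle.toCircle x : ℂ) = (R : ℂ)⁻¹ * z := by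
    refine ⟨((Complex.arg ((R : ℂ)⁻¹ * z) : ℝ) : AddCircle (2 * π)), ?_⟩
    have := Complex.norm_mul_exp_arg_mul_I ((R : ℂ)⁻¹ * z)
    rw [hz', Complex.ofReal_one, one_mul] at this
    rw [AddCircle.toCircle_apply_mk, div_self (by positivity), one_mul, Circle.coe_exp, this]
  have h1 : ‖F x - G x‖ < ε := by
    rw [← dist_eq_norm]; exact (ContinuousMap.dist_apply_le_dist x).trans_lt hGF
  have h2 := (Complex.abs_re_le_norm _).trans_lt h1
  have hR' : (R : ℂ) ≠ 0 := by exact_mod_cast hR.ne'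
  have h3 : (R : ℂ) * ((R : ℂ)⁻¹ * z) = z := by field_simp
  rw [hAB, hx'] at h2
  simpa [F, hx', h3] using h2

theorem circleAverage_re_eq {Q : ℂ → ℂ} (hQ : Differentiable ℂ Q) (R : ℝ) :
    circleAverage (fun z => (Q z).re) 0 R = (Q 0).re := by
  have := Complex.reCLM.circleAverage_comp_comm (f := Q) (c := 0) (R := R)
    (hQ.continuous.continuousOn.circleIntegrable')
  rw [DiffContOnCl.circleAverage hQ.diffContOnCl] at this
  simpa [Function.comp_def] using this

/-- Harnack's inequality for the real part of an entire function, from Poisson's formula. -/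
theorem re_harnack {Q : ℂ → ℂ} (hQ : Differentiable ℂ Q) {R : ℝ}
    (h0 : ∀ z ∈ sphere (0 : ℂ) R, 0 ≤ (Q z).re) {w : ℂ} (hw : ‖w‖ < R) :
    (R - ‖w‖) / (R + ‖w‖) * (Q 0).re ≤ (Q w).re ∧
      (Q w).re ≤ (R + ‖w‖) / (R - ‖w‖) * (Q 0).re := by
  have hR : 0 < R := (norm_nonneg _).trans_lt hw
  have hwb : w ∈ ball (0 : ℂ) R := by simpa using hw
  have hK : ContinuousOn (fun z : ℂ => ((z - 0 + (w - 0)) / ((z - 0) - (w - 0))).re)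
      (sphere 0 R) := by
    refine Complex.continuous_re.comp_continuousOn
      (ContinuousOn.div (by fun_prop) (by fun_prop) fun z hz h => ?_)
    obtain rfl : z = w := by simpa [sub_eq_zero] using h
    simp only [mem_sphere, mem_ball] at hz hwb
    linarith
  have key : Real.circleAverage
      (fun z => ((z - 0 + (w - 0)) / ((z - 0) - (w - 0))).re * (Q z).re) 0 R = (Q w).re := by
    have h1 := DiffContOnCl.circleAverage_re_herglotzRieszKernel_smul' hQ.diffContOnCl hwb
    have h2 := Complex.reCLM.circleAverage_comp_comm
      ((hK.smul hQ.continuous.continuousOn).circleIntegrable hR.le)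
    simp only [Pi.smul_def'] at h2
    rw [h1] at h2
    simpa [Function.comp_def] using h2
  have hci : CircleIntegrable
      (fun z => ((z - 0 + (w - 0)) / ((z - 0) - (w - 0))).re * (Q z).re) 0 R :=
    (hK.mul (Complex.continuous_re.comp hQ.continuous).continuousOn).circleIntegrable hR.le
  have hQi : CircleIntegrable (fun z => (Q z).re) 0 R :=
    (Complex.continuous_re.comp hQ.continuous).continuousOn.circleIntegrable hR.le
  rw [← key, ← circleAverage_re_eq hQ R, ← smul_eq_mul, ← smul_eq_mul, ← circleAverage_fun_smul,
    ← circleAverage_fun_smul]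
  constructor
  · refine circleAverage_mono (hQi.const_smul (a := (R - ‖w‖) / (R + ‖w‖))) hci
      fun z hz => ?_
    rw [abs_of_pos hR] at hz
    have := le_re_herglotzRieszKernel hz hwb
    simp only [smul_eq_mul]
    refine mul_le_mul_of_nonneg_right ?_ (h0 z hz)
    simpa using this
  · refine circleAverage_mono hci (hQi.const_smul (a := (R + ‖w‖) / (R - ‖w‖)))
      fun z hz => ?_
    rw [abs_of_pos hR] at hz
    have := re_herglotzRieszKernel_le hz hwb
    simp only [smul_eq_mul]
    refine mul_le_mul_of_nonneg_right ?_ (h0 z hz)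
    simpa using this

/-! ### Subharmonic functions of one variable -/

/-- `u` is bounded below near `c`, with equality at `c`, by the real part of a holomorphic
function. Continuous functions with this property at every point are subharmonic, and the property
is stable under sums, maxima and holomorphic substitutions. -/
def HolomorphicSupport (u : ℂ → ℝ) (c : ℂ) : Prop :=
  ∃ ψ : ℂ → ℂ, AnalyticAt ℂ ψ c ∧ (ψ c).re = u c ∧ ∀ᶠ z in 𝓝 c, (ψ z).re ≤ u z

theorem HolomorphicSupport.of_eventually_re_eq {u : ℂ → ℝ} {c : ℂ} {ψ : ℂ → ℂ}
    (hψ : AnalyticAt ℂ ψ c) (h : ∀ᶠ z in 𝓝 c, (ψ z).re = u z) : HolomorphicSupport u c :=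
  ⟨ψ, hψ, h.self_of_nhds, h.mono fun _ hz => hz.le⟩

theorem HolomorphicSupport.congr {u v : ℂ → ℝ} {c : ℂ} (hu : HolomorphicSupport u c)
    (h : u =ᶠ[𝓝 c] v) : HolomorphicSupport v c := by
  obtain ⟨ψ, h1, h2, h3⟩ := hu
  refine ⟨ψ, h1, h2.trans h.self_of_nhds, ?_⟩
  filter_upwards [h, h3] with z hz hz'
  exact hz ▸ hz'

theorem HolomorphicSupport.mono {u v : ℂ → ℝ} {c : ℂ} (hu : HolomorphicSupport u c)
    (hc : u c = v c) (h : ∀ᶠ z in 𝓝 c, u z ≤ v z) : HolomorphicSupport v c := by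
  obtain ⟨ψ, h1, h2, h3⟩ := hu
  refine ⟨ψ, h1, h2.trans hc, ?_⟩
  filter_upwards [h, h3] with z hz hz'
  exact hz'.trans hz

theorem HolomorphicSupport.max {u v : ℂ → ℝ} {c : ℂ} (hu : HolomorphicSupport u c)
    (hv : HolomorphicSupport v c) : HolomorphicSupport (fun z => max (u z) (v z)) c := by
  rcases le_total (u c) (v c) with h | h
  · exact hv.mono (max_eq_right h).symm (Eventually.of_forall fun z => le_max_right _ _)
  · exact hu.mono (max_eq_left h).symm (Eventually.of_forall fun z => le_max_left _ _)

theorem HolomorphicSupport.add {u v : ℂ → ℝ} {c : ℂ} (hu : HolomorphicSupport u c)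
    (hv : HolomorphicSupport v c) : HolomorphicSupport (fun z => u z + v z) c := by
  obtain ⟨ψ, h1, h2, h3⟩ := hu
  obtain ⟨φ, k1, k2, k3⟩ := hv
  refine ⟨ψ + φ, h1.add k1, by simp [h2, k2], ?_⟩
  filter_upwards [h3, k3] with z hz hz'
  simpa using add_le_add hz hz'

theorem HolomorphicSupport.comp {u : ℂ → ℝ} {F : ℂ → ℂ} {c : ℂ}
    (hu : HolomorphicSupport u (F c)) (hF : AnalyticAt ℂ F c) :
    HolomorphicSupport (fun z => u (F z)) c := by
  obtain ⟨ψ, h1, h2, h3⟩ := hu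
  exact ⟨ψ ∘ F, h1.comp hF, h2, hF.continuousAt.eventually h3⟩

theorem exists_analyticAt_re_eq_log_norm {F : ℂ → ℂ} {c : ℂ} (hF : AnalyticAt ℂ F c)
    (h0 : F c ≠ 0) :
    ∃ L : ℂ → ℂ, AnalyticAt ℂ L c ∧ ∀ᶠ z in 𝓝 c, (L z).re = Real.log ‖F z‖ := by
  refine ⟨fun z => Complex.log (F z / F c) + Complex.log (F c), ?_, ?_⟩
  · refine AnalyticAt.add (AnalyticAt.clog (hF.div analyticAt_const h0) ?_) analyticAt_const
    rw [div_self h0]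
    exact Complex.one_mem_slitPlane
  · filter_upwards [hF.continuousAt.eventually_ne h0] with z hz
    rw [Complex.add_re, Complex.log_re, Complex.log_re, norm_div,
      Real.log_div (norm_ne_zero_iff.2 hz) (norm_ne_zero_iff.2 h0)]
    ring

/-- Where `|F| > 1` the function `log⁺ |F|` is locally the real part of a branch of `log F`, and
elsewhere it is supported by `0`. -/
theorem HolomorphicSupport.posLog_norm {F : ℂ → ℂ} {c : ℂ} (hF : AnalyticAt ℂ F c) :
    HolomorphicSupport (fun z => log⁺ ‖F z‖) c := by
  by_cases h : 1 < ‖F c‖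
  · have h0 : F c ≠ 0 := norm_pos_iff.1 (one_pos.trans h)
    obtain ⟨L, hL, hL'⟩ := exists_analyticAt_re_eq_log_norm hF h0
    refine .of_eventually_re_eq hL ?_
    filter_upwards [hL', hF.continuousAt.norm.eventually (lt_mem_nhds h)] with z hz hz'
    rw [hz, posLog_eq_log (by rw [abs_norm]; exact hz'.le)]
  · refine ⟨fun _ => 0, analyticAt_const, ?_, Eventually.of_forall fun z => posLog_nonneg⟩
    rw [Complex.zero_re, eq_comm, posLog_eq_zero_iff, abs_norm]
    exact not_lt.1 h

/-- Some direction of `ζ` increases the norm of `l + ζ ^ 2`. -/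
theorem exists_norm_lt_norm_add_sq (l : ℂ) : ∃ e : ℂ, ∀ t : ℝ, 0 < t → ‖l‖ < ‖l + (t * e) ^ 2‖ := by
  by_cases h : l = 0
  · refine ⟨1, fun t ht => ?_⟩
    simpa [h] using pow_pos ht 2
  · obtain ⟨e, he⟩ := IsAlgClosed.exists_pow_nat_eq l (n := 2) (by norm_num)
    refine ⟨e, fun t ht => ?_⟩
    have : l + ((t : ℂ) * e) ^ 2 = ((1 + t ^ 2 : ℝ) : ℂ) * l := by
      push_cast; rw [mul_pow, he]; ring
    rw [this, norm_mul, Complex.norm_of_nonneg (by positivity)]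
    have hl : 0 < ‖l‖ := norm_pos_iff.2 h
    nlinarith [mul_pos (pow_pos ht 2) hl]

/-- The maximum principle for a function that is subharmonic in the sense that it has a holomorphic
support at every point `l`, possibly in terms of a square root of the local coordinate there. -/
theorem le_re_of_le_re_on_sphere {U : ℂ → ℝ} (hU : Continuous U)
    (hs : ∀ l : ℂ, HolomorphicSupport (fun ζ => U (l + ζ ^ 2)) 0)
    {Q : ℂ → ℂ} (hQ : Differentiable ℂ Q) {R : ℝ}
    (hle : ∀ z ∈ sphere (0 : ℂ) R, U z ≤ (Q z).re) :
    ∀ z ∈ closedBall (0 : ℂ) R, U z ≤ (Q z).re := by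
  by_contra! hcon
  obtain ⟨w, hw, hUw⟩ := hcon
  have hD : Continuous (fun z => U z - (Q z).re) :=
    hU.sub (Complex.continuous_re.comp hQ.continuous)
  obtain ⟨m, hm, hmax⟩ := (isCompact_closedBall (0 : ℂ) R).exists_isMaxOn ⟨w, hw⟩ hD.continuousOn
  set M := U m - (Q m).re with hM
  have hMpos : 0 < M := lt_of_lt_of_le (sub_pos.2 hUw) (hmax hw)
  -- Among the maximum points of the difference, take one that is farthest from the origin.
  obtain ⟨l, ⟨hl, hlM⟩, hlmax⟩ := ((isCompact_closedBall (0 : ℂ) R).inter_right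
    (isClosed_singleton.preimage hD : IsClosed ((fun z => U z - (Q z).re) ⁻¹' {M}))).exists_isMaxOn
    ⟨m, hm, rfl⟩ continuous_norm.continuousOn
  simp only [Set.mem_preimage, Set.mem_singleton_iff] at hlM
  have hlR : ‖l‖ < R := by
    refine lt_of_le_of_ne (by simpa using hl) fun h => ?_
    have := hle l (by simpa using h)
    linarith
  obtain ⟨χ, hχ, hχ0, hχle⟩ := hs l
  have hc : Tendsto (fun ζ : ℂ => l + ζ ^ 2) (𝓝 0) (𝓝 l) := by
    have : Continuous (fun ζ : ℂ => l + ζ ^ 2) := by fun_prop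
    simpa using this.tendsto 0
  have hball : ∀ᶠ ζ : ℂ in 𝓝 0, ‖l + ζ ^ 2‖ < R :=
    (continuous_norm.tendsto l).comp hc |>.eventually (gt_mem_nhds hlR)
  -- `exp` of the holomorphic support minus `Q` has a local maximum of its norm, so is locally
  -- constant, although some nearby points `l + ζ ^ 2` are farther from the origin than `l`.
  let Φ : ℂ → ℂ := fun ζ => Complex.exp (χ ζ - Q (l + ζ ^ 2))
  have hΦn : ∀ ζ, ‖Φ ζ‖ = Real.exp ((χ ζ).re - (Q (l + ζ ^ 2)).re) := fun ζ => by
    simp [Φ, Complex.norm_exp]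
  have hΦ0 : ‖Φ 0‖ = Real.exp M := by
    rw [hΦn, hχ0]; simp [hlM]
  have hloc : IsLocalMax (norm ∘ Φ) 0 := by
    filter_upwards [hχle, hball] with ζ h1 h2
    simp only [Function.comp_apply]
    rw [hΦ0, hΦn, Real.exp_le_exp]
    have := hmax (show l + ζ ^ 2 ∈ closedBall 0 R by simpa using h2.le)
    simp only [Set.mem_ofPred_eq] at this
    linarith
  have hdiff : ∀ᶠ ζ in 𝓝 (0 : ℂ), DifferentiableAt ℂ Φ ζ := by
    filter_upwards [hχ.eventually_analyticAt] with ζ hζ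
    exact (hζ.differentiableAt.sub ((hQ _).comp ζ (by fun_prop))).cexp
  have hconst := Complex.eventually_eq_of_isLocalMax_norm hdiff hloc
  obtain ⟨e, he⟩ := exists_norm_lt_norm_add_sq l
  have ht : Tendsto (fun t : ℝ => (t : ℂ) * e) (𝓝[>] 0) (𝓝 0) := by
    have : Continuous (fun t : ℝ => (t : ℂ) * e) := by fun_prop
    have h := this.tendsto 0
    simp only [Complex.ofReal_zero, zero_mul] at h
    exact h.mono_left nhdsWithin_le_nhds
  obtain ⟨t, ⟨h1, h2, h3⟩, h4⟩ :=
    ((ht.eventually (hconst.and (hχle.and hball))).and self_mem_nhdsWithin).exists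
  have h5 : U (l + (t * e) ^ 2) - (Q (l + (t * e) ^ 2)).re = M := by
    refine le_antisymm (hmax (show _ ∈ closedBall (0 : ℂ) R by simpa using h3.le)) ?_
    have := congrArg norm h1
    rw [hΦ0, hΦn, Real.exp_eq_exp] at this
    linarith
  have h6 := hlmax (show _ ∈ closedBall (0 : ℂ) R ∩ _ from ⟨by simpa using h3.le, h5⟩)
  simp only [Set.mem_ofPred_eq] at h6
  exact absurd h6 (not_le.2 (he t h4))

/-- A function that is subharmonic in the sense of `hs` lies below the real part of an entire
function whose value at the origin is nearly the mean over a circle. -/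
theorem exists_re_majorant {U : ℂ → ℝ} (hU : Continuous U)
    (hs : ∀ l : ℂ, HolomorphicSupport (fun ζ => U (l + ζ ^ 2)) 0) {R : ℝ} (hR : 0 < R)
    {ε : ℝ} (hε : 0 < ε) :
    ∃ Q : ℂ → ℂ, Differentiable ℂ Q ∧ (∀ z ∈ closedBall (0 : ℂ) R, U z ≤ (Q z).re) ∧
      (Q 0).re ≤ circleAverage U 0 R + ε := by
  obtain ⟨Q, hQ, hUQ⟩ := exists_differentiable_re_approx hU hR (half_pos hε)
  have hQ' : Differentiable ℂ (fun z => Q z + (ε / 2 : ℝ)) := by fun_prop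
  have hsph : ∀ z ∈ sphere (0 : ℂ) R, U z ≤ (Q z + (ε / 2 : ℝ)).re := fun z hz => by
    have := (abs_lt.1 (hUQ z hz)).2
    rw [Complex.add_re, Complex.ofReal_re]
    linarith
  refine ⟨_, hQ', le_re_of_le_re_on_sphere hU hs hQ' hsph, ?_⟩
  have hsum : circleAverage (fun z => U z + ε) 0 R = circleAverage U 0 R + ε := by
    rw [circleAverage_fun_add hU.continuousOn.circleIntegrable'
      continuousOn_const.circleIntegrable', circleAverage_const]
  rw [← circleAverage_re_eq hQ' R, ← hsum]
  refine circleAverage_mono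
    (Complex.continuous_re.comp hQ'.continuous).continuousOn.circleIntegrable'
    (hU.add continuous_const).continuousOn.circleIntegrable' fun z hz => ?_
  rw [abs_of_pos hR] at hz
  have := (abs_lt.1 (hUQ z hz)).1
  rw [Complex.add_re, Complex.ofReal_re]
  linarith

/-- The mean value inequality. -/
theorem le_circleAverage {U : ℂ → ℝ} (hU : Continuous U)
    (hs : ∀ l : ℂ, HolomorphicSupport (fun ζ => U (l + ζ ^ 2)) 0) {R : ℝ} (hR : 0 < R) :
    U 0 ≤ circleAverage U 0 R := by
  refine le_of_forall_pos_le_add fun ε hε => ?_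
  obtain ⟨Q, -, h, h0⟩ := exists_re_majorant hU hs hR hε
  exact (h 0 (by simp [hR.le])).trans h0

/-- Harnack's inequality for nonnegative subharmonic functions, on the disc of half the radius. -/
theorem le_three_mul_circleAverage {U : ℂ → ℝ} (hU : Continuous U)
    (hs : ∀ l : ℂ, HolomorphicSupport (fun ζ => U (l + ζ ^ 2)) 0) (h0 : ∀ z, 0 ≤ U z)
    {R : ℝ} (hR : 0 < R) {w : ℂ} (hw : 2 * ‖w‖ ≤ R) :
    U w ≤ 3 * circleAverage U 0 R := by
  refine le_of_forall_pos_le_add fun ε hε => ?_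
  obtain ⟨Q, hQ, h, hQ0⟩ := exists_re_majorant hU hs hR (show 0 < ε / 3 by positivity)
  have hwR : ‖w‖ < R := by nlinarith [norm_nonneg w]
  have h1 := (re_harnack hQ (fun z hz => (h0 z).trans (h z (sphere_subset_closedBall hz))) hwR).2
  have h2 : (R + ‖w‖) / (R - ‖w‖) ≤ 3 := by
    rw [div_le_iff₀ (by linarith)]; linarith
  have h3 : 0 ≤ (Q 0).re := (h0 0).trans (h 0 (by simp [hR.le]))
  have h4 := h w (by simpa using hwR.le)
  nlinarith [mul_le_mul_of_nonneg_right h2 h3]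

/-! ### Growth of transcendental entire functions -/

/-- An entire function of polynomial growth is a polynomial. -/
theorem exists_polynomial_of_norm_le {g : ℂ → ℂ} (hg : Differentiable ℂ g) {A : ℝ} {N : ℕ}
    (h : ∀ w : ℂ, 1 ≤ ‖w‖ → ‖g w‖ ≤ A * ‖w‖ ^ N) :
    ∃ q : Polynomial ℂ, ∀ w, g w = q.eval w := by
  have hzero : ∀ n, N < n → iteratedDeriv n g 0 = 0 := by
    intro n hn
    have hlim : Tendsto (fun R : ℝ => (n.factorial * A) * R⁻¹) atTop (𝓝 0) := by
      simpa using tendsto_inv_atTop_zero.const_mul ((n.factorial : ℝ) * A)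
    refine norm_le_zero_iff.1 (ge_of_tendsto hlim ?_)
    filter_upwards [eventually_ge_atTop 1] with R hR
    have hR0 : 0 < R := by linarith
    have h1 := Complex.norm_iteratedDeriv_le_of_forall_mem_sphere_norm_le n hR0
      (hg.diffContOnCl (s := ball 0 R)) (C := A * R ^ N) fun z hz => by
        have hz' : ‖z‖ = R := by simpa using hz
        simpa [hz'] using h z (by rw [hz']; exact hR)
    refine h1.trans ?_
    have hA : 0 ≤ A := by simpa using (norm_nonneg _).trans (h 1 (by simp))
    have h2 : R ^ N * R ≤ R ^ n := by
      rw [← pow_succ]; exact pow_le_pow_right₀ hR hn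
    rw [div_le_iff₀ (by positivity), mul_assoc, mul_assoc]
    refine mul_le_mul_of_nonneg_left (mul_le_mul_of_nonneg_left ?_ hA) (by positivity)
    calc R ^ N = R⁻¹ * (R ^ N * R) := by field_simp
      _ ≤ R⁻¹ * R ^ n := by gcongr
  refine ⟨∑ n ∈ Finset.range (N + 1),
    Polynomial.C ((n.factorial : ℂ)⁻¹ * iteratedDeriv n g 0) * Polynomial.X ^ n, fun w => ?_⟩
  rw [← Complex.taylorSeries_eq_of_entire' 0 w hg, tsum_eq_sum (s := Finset.range (N + 1))
    (fun n hn => by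
      rw [hzero n (by simpa [Nat.lt_succ_iff] using hn)]; simp)]
  simp [Polynomial.eval_finsetSum]

theorem continuous_posLog_norm {g : ℂ → ℂ} (hg : Continuous g) :
    Continuous (fun w => log⁺ ‖g w‖) := continuous_posLog.comp hg.norm

/-- The Nevanlinna characteristic of a transcendental entire function outgrows every multiple
of `log R`. -/
theorem IsTranscendentalEntire.exists_lt_circleAverage {g : ℂ → ℂ}
    (hg : IsTranscendentalEntire g) (K C : ℝ) :
    ∃ R : ℝ, 2 ≤ R ∧ K * Real.log R + C < circleAverage (fun w => log⁺ ‖g w‖) 0 R := by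
  by_contra! hcon
  -- Otherwise Harnack's inequality bounds `|g|` by a power of `|w|`.
  refine hg.2 (exists_polynomial_of_norm_le hg.1 (A := Real.exp (3 * |C|) * 2 ^ ⌈3 * |K|⌉₊)
    (N := ⌈3 * |K|⌉₊) fun w hw => ?_)
  have hw0 : 0 < ‖w‖ := by linarith
  have hs : ∀ l : ℂ, HolomorphicSupport (fun ζ => log⁺ ‖g (l + ζ ^ 2)‖) 0 := fun l =>
    .posLog_norm ((hg.1.comp (by fun_prop : Differentiable ℂ fun ζ : ℂ => l + ζ ^ 2)).analyticAt 0)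
  have h1 := le_three_mul_circleAverage (continuous_posLog_norm hg.1.continuous) hs
    (fun z => posLog_nonneg) (R := 2 * ‖w‖) (by positivity) (w := w) le_rfl
  have h2 := hcon (2 * ‖w‖) (by linarith)
  have hlog : 0 ≤ Real.log (2 * ‖w‖) := Real.log_nonneg (by linarith)
  have h3 : log⁺ ‖g w‖ ≤ 3 * |C| + ⌈3 * |K|⌉₊ * Real.log (2 * ‖w‖) := by
    have := mul_le_mul_of_nonneg_right (Nat.le_ceil (3 * |K|)) hlog
    have := mul_le_mul_of_nonneg_right (le_abs_self K) hlog
    have := le_abs_self C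
    linarith
  have h4 : ‖g w‖ ≤ Real.exp (log⁺ ‖g w‖) := by
    rw [posLog_eq_log_max_one (norm_nonneg _), Real.exp_log (by positivity)]
    exact le_max_right _ _
  refine h4.trans ((Real.exp_le_exp.2 h3).trans_eq ?_)
  rw [Real.exp_add, mul_assoc, ← mul_pow, ← Real.exp_log (show 0 < 2 * ‖w‖ by positivity),
    ← Real.exp_nat_mul, Real.log_exp]

/-- For every `K` the function `log⁺ |g|` of a transcendental entire function `g` exceeds
`K log⁺ |w|` by at least a subharmonic function. -/
theorem IsTranscendentalEntire.exists_minorant {g : ℂ → ℂ} (hg : IsTranscendentalEntire g)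
    (K : ℝ) :
    ∃ h : ℂ → ℝ, Continuous h ∧ (∀ w, HolomorphicSupport h w) ∧
      ∀ w, K * log⁺ ‖w‖ + h w ≤ log⁺ ‖g w‖ := by
  set v : ℂ → ℝ := fun w => log⁺ ‖g w‖ with hv
  have hvc : Continuous v := continuous_posLog_norm hg.1.continuous
  obtain ⟨m, hm⟩ := (isCompact_closedBall (0 : ℂ) 1).bddAbove_image hvc.continuousOn
  have hm' : ∀ w : ℂ, ‖w‖ ≤ 1 → v w ≤ m := fun w hw =>
    hm (Set.mem_image_of_mem _ (by simpa using hw))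
  obtain ⟨R, hR, hRv⟩ := hg.exists_lt_circleAverage (3 * K) (3 * (m + 4))
  have hR0 : 0 < R := by linarith
  obtain ⟨Q, hQ, hQv⟩ := exists_differentiable_re_approx hvc hR0 one_pos
  set s : ℂ → ℝ := fun w => (Q w).re - K * Real.log R - 2 with hs
  have hsc : Continuous s := by
    have := Complex.continuous_re.comp hQ.continuous
    simp only [hs]; fun_prop
  set k : ℂ → ℝ := fun w => v w - K * Real.log ‖w‖ with hk
  have hkc : ∀ w, w ≠ 0 → ContinuousAt k w := fun w hw =>
    hvc.continuousAt.sub (continuousAt_const.mul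
      (continuous_norm.continuousAt.log (norm_ne_zero_iff.2 hw)))
  have hss : ∀ w, HolomorphicSupport s w := fun w =>
    .of_eventually_re_eq (ψ := fun w => Q w - (K * Real.log R + 2 : ℝ))
      ((hQ.analyticAt w).sub analyticAt_const)
      (Eventually.of_forall fun z => by simp only [hs, Complex.sub_re, Complex.ofReal_re]; ring)
  have hks : ∀ w, w ≠ 0 → HolomorphicSupport k w := fun w hw => by
    obtain ⟨L, hL, hL'⟩ := exists_analyticAt_re_eq_log_norm (F := fun z => z) analyticAt_id hw
    refine ((HolomorphicSupport.posLog_norm (hg.1.analyticAt w)).add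
      (.of_eventually_re_eq (u := fun z => -K * Real.log ‖z‖) (ψ := fun z => (-K : ℝ) * L z)
        (analyticAt_const.mul hL) ?_)).congr (Eventually.of_forall fun z => ?_)
    · filter_upwards [hL'] with z hz
      rw [Complex.re_ofReal_mul, hz]
    · simp only [hk, hv]; ring
  -- On the circle of radius `R` the function `k` dominates, on the unit circle `s` does.
  have hout : ∀ w : ℂ, ‖w‖ = R → s w < k w := fun w hw => by
    have := (abs_lt.1 (hQv w (by simpa using hw))).1
    simp only [hs, hk, hw]; linarith
  have hin : ∀ w : ℂ, ‖w‖ = 1 → k w < s w := fun w hw => by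
    have hQ1 : Differentiable ℂ (fun z => Q z + 1) := by fun_prop
    have h1 := (re_harnack hQ1 (R := R) (fun z hz => by
      have := (abs_lt.1 (hQv z hz)).2
      have : 0 ≤ v z := posLog_nonneg
      rw [Complex.add_re, Complex.one_re]; linarith) (w := w) (by rw [hw]; linarith)).1
    have h2 : circleAverage v 0 R ≤ (Q 0 + 1).re := by
      rw [← circleAverage_re_eq hQ1 R]
      refine circleAverage_mono hvc.continuousOn.circleIntegrable'
        (Complex.continuous_re.comp hQ1.continuous).continuousOn.circleIntegrable' fun z hz => ?_
      rw [abs_of_pos hR0] at hz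
      have := (abs_lt.1 (hQv z hz)).2
      rw [Complex.add_re, Complex.one_re]; linarith
    have h3 : (1 : ℝ) / 3 ≤ (R - ‖w‖) / (R + ‖w‖) := by
      rw [hw, div_le_div_iff₀ (by norm_num) (by linarith)]; linarith
    have h4 : 0 ≤ (Q 0 + 1).re :=
      (circleAverage_nonneg_of_nonneg fun z _ => posLog_nonneg).trans h2
    have h5 := mul_le_mul_of_nonneg_right h3 h4
    have h6 := hm' w hw.le
    simp only [Complex.add_re, Complex.one_re] at h1 h2 h5
    simp only [hs, hk, hw, Real.log_one]
    change _ < circleAverage v 0 R at hRv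
    linarith
  -- Hence `h` is continuous and near every point equal to `s`, to `k`, or to their maximum.
  set h : ℂ → ℝ := fun w => if ‖w‖ ≤ 1 then s w else if ‖w‖ < R then max (s w) (k w) else k w
    with hh
  have hloc : ∀ w, ContinuousAt h w ∧ HolomorphicSupport h w := by
    intro w
    have hnorm : ContinuousAt (fun z : ℂ => ‖z‖) w := continuous_norm.continuousAt
    have of_s : s =ᶠ[𝓝 w] h → ContinuousAt h w ∧ HolomorphicSupport h w := fun e =>
      ⟨hsc.continuousAt.congr e, (hss w).congr e⟩
    have of_k : w ≠ 0 → k =ᶠ[𝓝 w] h → ContinuousAt h w ∧ HolomorphicSupport h w := fun h0 e =>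
      ⟨(hkc w h0).congr e, (hks w h0).congr e⟩
    rcases lt_trichotomy ‖w‖ 1 with h1 | h1 | h1
    · refine of_s ?_
      filter_upwards [hnorm.eventually (gt_mem_nhds h1)] with z hz
      simp only [hh]; rw [if_pos hz.le]
    · have h0 : w ≠ 0 := norm_ne_zero_iff.1 (by rw [h1]; norm_num)
      refine of_s ?_
      filter_upwards [hnorm.eventually (gt_mem_nhds (show ‖w‖ < R by linarith)),
        (hkc w h0).eventually_lt hsc.continuousAt (hin w h1)] with z hz hz'
      simp only [hh]; rw [if_pos hz, max_eq_left hz'.le, ite_self]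
    · have h0 : w ≠ 0 := norm_ne_zero_iff.1 (by linarith)
      rcases lt_trichotomy ‖w‖ R with h2 | h2 | h2
      · have e : (fun z => max (s z) (k z)) =ᶠ[𝓝 w] h := by
          filter_upwards [hnorm.eventually (gt_mem_nhds h2),
            hnorm.eventually (lt_mem_nhds h1)] with z hz hz'
          simp only [hh]; rw [if_neg (not_le.2 hz'), if_pos hz]
        exact ⟨ContinuousAt.congr (hsc.continuousAt.max (hkc w h0)) e,
          ((hss w).max (hks w h0)).congr e⟩
      · refine of_k h0 ?_
        filter_upwards [hnorm.eventually (lt_mem_nhds h1),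
          hsc.continuousAt.eventually_lt (hkc w h0) (hout w h2)] with z hz hz'
        simp only [hh]; rw [if_neg (not_le.2 hz), max_eq_right hz'.le, ite_self]
      · refine of_k h0 ?_
        filter_upwards [hnorm.eventually (lt_mem_nhds h1),
          hnorm.eventually (lt_mem_nhds h2)] with z hz hz'
        simp only [hh]; rw [if_neg (not_le.2 hz), if_neg (not_lt.2 hz'.le)]
  have hhc : Continuous h := continuous_iff_continuousAt.2 fun w => (hloc w).1
  -- Outside the disc of radius `R` the inequality is an equality; inside, a constant is subtracted.
  obtain ⟨B, hB⟩ := (isCompact_closedBall (0 : ℂ) R).bddAbove_image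
    (f := fun w => K * log⁺ ‖w‖ + h w - v w)
    (((continuous_const.mul (continuous_posLog.comp continuous_norm)).add hhc).sub
      hvc).continuousOn
  refine ⟨fun w => h w + -max B 0, hhc.add continuous_const, fun w => (hloc w).2.add
    (.of_eventually_re_eq (ψ := fun _ => (-max B 0 : ℝ)) analyticAt_const
      (Eventually.of_forall fun z => Complex.ofReal_re _)), fun w => ?_⟩
  rcases le_or_gt ‖w‖ R with h1 | h1
  · have := hB (Set.mem_image_of_mem _ (show w ∈ closedBall (0 : ℂ) R by simpa using h1))
    have := le_max_left B 0
    simp only at *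
    linarith
  · have h2 : 1 < ‖w‖ := by linarith
    have h3 : h w = v w - K * Real.log ‖w‖ := by
      simp only [hh]; rw [if_neg (not_le.2 h2), if_neg (not_lt.2 h1.le)]
    change K * log⁺ ‖w‖ + (h w + -max B 0) ≤ v w
    rw [h3, posLog_eq_log (by rw [abs_norm]; exact h2.le)]
    have := le_max_right B 0
    linarith

/-! ### The two points of the surface above a point of the plane -/

/-- The branch near `a ≠ 0` of the square root with the value `e` at `a`, where `e ^ 2 = a`. -/
def sqrtNear (a e z : ℂ) : ℂ := e * (z / a) ^ (1 / 2 : ℂ)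

theorem cpow_half_sq (z : ℂ) : (z ^ (1 / 2 : ℂ)) ^ 2 = z := by
  rw [← Complex.cpow_nat_mul]; norm_num

theorem sqrtNear_sq {a e : ℂ} (ha : a ≠ 0) (he : e ^ 2 = a) (z : ℂ) : sqrtNear a e z ^ 2 = z := by
  rw [sqrtNear, mul_pow, cpow_half_sq, he]; field_simp

theorem sqrtNear_self {a : ℂ} (ha : a ≠ 0) (e : ℂ) : sqrtNear a e a = e := by
  rw [sqrtNear, div_self ha, Complex.one_cpow, mul_one]

theorem analyticAt_sqrtNear {a : ℂ} (ha : a ≠ 0) (e : ℂ) : AnalyticAt ℂ (sqrtNear a e) a := by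
  refine analyticAt_const.mul (AnalyticAt.cpow (analyticAt_id.div analyticAt_const ha)
    analyticAt_const ?_)
  rw [div_self ha]
  exact Complex.one_mem_slitPlane

theorem tendsto_cpow_half_zero : Tendsto (fun z : ℂ => z ^ (1 / 2 : ℂ)) (𝓝 0) (𝓝 0) := by
  have h : ContinuousAt (fun z : ℂ => z ^ (1 / 2 : ℂ)) 0 :=
    Complex.continuousAt_cpow_const_of_re_pos (Or.inl le_rfl) (by norm_num)
  simpa [ContinuousAt] using h

/-- A continuous function is holomorphic if it becomes so after the substitutions
`z = l + ζ ^ 2`. -/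
theorem differentiable_of_analyticAt_add_sq {S : ℂ → ℂ} (hS : Continuous S)
    (h : ∀ l : ℂ, AnalyticAt ℂ (fun ζ => S (l + ζ ^ 2)) 0) : Differentiable ℂ S := by
  intro l
  refine (Complex.analyticAt_of_differentiable_on_punctured_nhds_of_continuousAt ?_
    hS.continuousAt).differentiableAt
  have ht : Tendsto (fun z : ℂ => (z - l) ^ (1 / 2 : ℂ)) (𝓝 l) (𝓝 0) := by
    refine tendsto_cpow_half_zero.comp ?_
    have : Continuous (fun z : ℂ => z - l) := by fun_prop
    simpa using this.tendsto l
  filter_upwards [(ht.eventually (h l).eventually_analyticAt).filter_mono nhdsWithin_le_nhds,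
    self_mem_nhdsWithin] with z hz hzl
  have ha : z - l ≠ 0 := sub_ne_zero.2 hzl
  set e := (z - l) ^ (1 / 2 : ℂ)
  have he : e ^ 2 = z - l := cpow_half_sq _
  have hb : DifferentiableAt ℂ (fun y => sqrtNear (z - l) e (y - l)) z :=
    ((analyticAt_sqrtNear ha e).differentiableAt).comp z (f := fun y => y - l) (by fun_prop)
  have hT : DifferentiableAt ℂ (fun ζ => S (l + ζ ^ 2)) (sqrtNear (z - l) e (z - l)) := by
    rw [sqrtNear_self ha]; exact hz.differentiableAt
  have := hT.comp z hb
  refine this.congr_of_eventuallyEq (Eventually.of_forall fun y => ?_)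
  simp [sqrtNear_sq ha he]

/-- A holomorphic function has a holomorphic square root after a substitution `z = l + ζ ^ 2`. -/
theorem exists_analyticAt_sq_eq {D : ℂ → ℂ} {l : ℂ} (hD : AnalyticAt ℂ D l) :
    ∃ σ : ℂ → ℂ, AnalyticAt ℂ σ 0 ∧ ∀ᶠ ζ in 𝓝 (0 : ℂ), σ ζ ^ 2 = D (l + ζ ^ 2) := by
  have ht : Tendsto (fun ζ : ℂ => l + ζ ^ 2) (𝓝 0) (𝓝 l) := by
    have : Continuous (fun ζ : ℂ => l + ζ ^ 2) := by fun_prop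
    simpa using this.tendsto 0
  by_cases h0 : ∀ᶠ z in 𝓝 l, D z = 0
  · refine ⟨fun _ => 0, analyticAt_const, ?_⟩
    filter_upwards [ht.eventually h0] with ζ hζ
    simp [hζ]
  -- If `D = (z - l) ^ n k` with `k l ≠ 0`, the root is `ζ ^ n` times a root of `k (l + ζ ^ 2)`.
  · obtain ⟨n, k, hk, hk0, hDk⟩ := hD.exists_eventuallyEq_pow_smul_nonzero_iff.2 h0
    set e := k l ^ (1 / 2 : ℂ)
    have he : e ^ 2 = k l := cpow_half_sq _
    refine ⟨fun ζ => ζ ^ n * sqrtNear (k l) e (k (l + ζ ^ 2)), ?_, ?_⟩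
    · refine (analyticAt_id.pow n).mul ?_
      have h1 : AnalyticAt ℂ (fun ζ : ℂ => l + ζ ^ 2) 0 := by fun_prop
      have h2 : AnalyticAt ℂ (fun ζ : ℂ => k (l + ζ ^ 2)) 0 :=
        AnalyticAt.comp (g := k) (by simpa using hk) h1
      exact AnalyticAt.comp (g := sqrtNear (k l) e) (by simpa using analyticAt_sqrtNear hk0 e) h2
    · filter_upwards [ht.eventually hDk] with ζ hζ
      rw [hζ, mul_pow, sqrtNear_sq hk0 he, smul_eq_mul]
      ring

/-- A quarter of the discriminant of the quadratic equation for the first coordinate of the points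
of the surface over `w`. -/
def disc (p : Polynomial ℂ) (w : ℂ × ℂ) : ℂ := w.1 ^ 2 / 4 - p.eval w.2

/-- The point over `w` that belongs to the square root `s` of the discriminant. -/
def rootPoint (w : ℂ × ℂ) (s : ℂ) : ℂ × ℂ × ℂ := (w.1 / 2 + s, w.1 / 2 - s, w.2)

theorem continuous_disc (p : Polynomial ℂ) : Continuous (disc p) := by
  unfold disc; fun_prop

theorem rootPoint_mem {p : Polynomial ℂ} {w : ℂ × ℂ} {s : ℂ} (hs : s ^ 2 = disc p w) :
    rootPoint w s ∈ surface p := by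
  simp only [surface, rootPoint, Set.mem_ofPred_eq, disc] at *
  linear_combination -hs

theorem sheet_pair {p : Polynomial ℂ} {w : ℂ × ℂ} {s : ℂ} (hs : s ^ 2 = disc p w) :
    (sheet p 1 w = rootPoint w s ∧ sheet p (-1) w = rootPoint w (-s)) ∨
      (sheet p 1 w = rootPoint w (-s) ∧ sheet p (-1) w = rootPoint w s) := by
  have h : (disc p w ^ (1 / 2 : ℂ)) ^ 2 = s ^ 2 := by rw [cpow_half_sq, hs]
  rcases sq_eq_sq_iff_eq_or_eq_neg.1 h with h | h <;> simp only [disc] at h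
  · left
    constructor <;> simp only [sheet, rootPoint, h] <;> simp [sub_eq_add_neg]
  · right
    constructor <;> simp only [sheet, rootPoint, h] <;> simp [sub_eq_add_neg]

/-- In a symmetric expression the two sheets may be replaced by the points belonging to any choice
of the square root. -/
theorem symm_sheet_eq {E : Type*} {G : ℂ × ℂ × ℂ → ℂ × ℂ × ℂ → E} (hG : ∀ a b, G a b = G b a)
    {p : Polynomial ℂ} {w : ℂ × ℂ} {s : ℂ} (hs : s ^ 2 = disc p w) :
    G (sheet p 1 w) (sheet p (-1) w) = G (rootPoint w s) (rootPoint w (-s)) := by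
  rcases sheet_pair hs with ⟨h1, h2⟩ | ⟨h1, h2⟩
  · rw [h1, h2]
  · rw [h1, h2, hG]

theorem exists_continuousAt_sqrt_disc (p : Polynomial ℂ) (w₀ : ℂ × ℂ) :
    ∃ s : ℂ × ℂ → ℂ, ContinuousAt s w₀ ∧ ∀ w, s w ^ 2 = disc p w := by
  by_cases h : disc p w₀ = 0
  · refine ⟨fun w => disc p w ^ (1 / 2 : ℂ), ?_, fun w => cpow_half_sq _⟩
    have : Tendsto (fun w => disc p w) (𝓝 w₀) (𝓝 0) := h ▸ (continuous_disc p).tendsto w₀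
    have := tendsto_cpow_half_zero.comp this
    simpa [ContinuousAt, h, Function.comp_def] using this
  · refine ⟨fun w => sqrtNear (disc p w₀) (disc p w₀ ^ (1 / 2 : ℂ)) (disc p w), ?_,
      fun w => sqrtNear_sq h (cpow_half_sq _) _⟩
    exact ContinuousAt.comp (g := sqrtNear (disc p w₀) _) (f := disc p)
      (analyticAt_sqrtNear h _).continuousAt (continuous_disc p).continuousAt

/-- A symmetric continuous function of the two points over `w` is continuous in `w`, although each
single point jumps across the cut of the square root. -/
theorem continuous_symm_sheet {E : Type*} [TopologicalSpace E]
    {G : ℂ × ℂ × ℂ → ℂ × ℂ × ℂ → E} (hG : ∀ a b, G a b = G b a) {p : Polynomial ℂ}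
    (hc : ContinuousOn (fun a : (ℂ × ℂ × ℂ) × (ℂ × ℂ × ℂ) => G a.1 a.2)
      (surface p ×ˢ surface p)) :
    Continuous fun w => G (sheet p 1 w) (sheet p (-1) w) := by
  refine continuous_iff_continuousAt.2 fun w₀ => ?_
  obtain ⟨s, hs, hsq⟩ := exists_continuousAt_sqrt_disc p w₀
  have hneg : ∀ w, (-s w) ^ 2 = disc p w := fun w => by rw [neg_sq, hsq]
  have e : (fun w => G (sheet p 1 w) (sheet p (-1) w)) =
      fun w => G (rootPoint w (s w)) (rootPoint w (-s w)) := by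
    ext w; exact symm_sheet_eq hG (hsq w)
  rw [e]
  have hpt : ContinuousAt (fun w => (rootPoint w (s w), rootPoint w (-s w))) w₀ := by
    unfold rootPoint; fun_prop
  exact (hc (rootPoint w₀ (s w₀), rootPoint w₀ (-s w₀))
    ⟨rootPoint_mem (hsq w₀), rootPoint_mem (hneg w₀)⟩).tendsto.comp
    (tendsto_nhdsWithin_iff.2 ⟨hpt, Eventually.of_forall fun w =>
      ⟨rootPoint_mem (hsq w), rootPoint_mem (hneg w)⟩⟩)

/-- Extension by zero of a function on the surface to the ambient space. -/
def extend {p : Polynomial ℂ} (f : surface p → ℂ) : ℂ × ℂ × ℂ → ℂ := Function.extend Subtype.val f 0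

theorem extend_apply {p : Polynomial ℂ} (f : surface p → ℂ) (q : surface p) :
    extend f q = f q := Subtype.val_injective.extend_apply f 0 q

theorem extend_of_mem {p : Polynomial ℂ} (f : surface p → ℂ) {q : ℂ × ℂ × ℂ}
    (h : q ∈ surface p) : extend f q = f ⟨q, h⟩ := extend_apply f ⟨q, h⟩

theorem IsHolomorphic.continuousOn {p : Polynomial ℂ} {f : surface p → ℂ}
    (hf : IsHolomorphic f) : ContinuousOn (extend f) (surface p) := by
  intro q hq
  obtain ⟨U, F, hU, hqU, hF, hfF⟩ := hf ⟨q, hq⟩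
  have hc : ContinuousWithinAt F (surface p) q :=
    ((hF.continuousOn).continuousAt (hU.mem_nhds hqU)).continuousWithinAt
  refine hc.congr_of_eventuallyEq ?_ ?_
  · filter_upwards [mem_nhdsWithin_of_mem_nhds (hU.mem_nhds hqU), self_mem_nhdsWithin] with s h1 h2
    rw [extend_of_mem f h2, hfF ⟨s, h2⟩ h1]
  · rw [extend_of_mem f hq, hfF ⟨q, hq⟩ hqU]

theorem IsHolomorphic.analyticAt_comp {p : Polynomial ℂ} {f : surface p → ℂ}
    (hf : IsHolomorphic f) {γ : ℂ → ℂ × ℂ × ℂ} {c : ℂ} (hγ : AnalyticAt ℂ γ c)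
    (hm : ∀ᶠ z in 𝓝 c, γ z ∈ surface p) : AnalyticAt ℂ (fun z => extend f (γ z)) c := by
  obtain ⟨U, F, hU, hqU, hF, hfF⟩ := hf ⟨γ c, hm.self_of_nhds⟩
  have hUc : ∀ᶠ z in 𝓝 c, γ z ∈ U := hγ.continuousAt.eventually (hU.mem_nhds hqU)
  have hd : ∀ᶠ z in 𝓝 c, DifferentiableAt ℂ (fun z => F (γ z)) z := by
    filter_upwards [hUc, hγ.eventually_analyticAt] with z h1 h2
    exact (hF.differentiableAt (hU.mem_nhds h1)).comp z h2.differentiableAt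
  refine (Complex.analyticAt_iff_eventually_differentiableAt.2 hd).congr ?_
  filter_upwards [hUc, hm] with z h1 h2
  rw [extend_of_mem f h2, hfF ⟨γ z, h2⟩ h1]

/-- Along a line through the origin of `ℂ²`, the two points of the surface are given near each
parameter `l` by two holomorphic curves, after the substitution `l + ζ ^ 2`. -/
theorem IsHolomorphic.exists_branches {p : Polynomial ℂ} {f : surface p → ℂ}
    (hf : IsHolomorphic f) (w : ℂ × ℂ) (l : ℂ) :
    ∃ A B : ℂ → ℂ, AnalyticAt ℂ A 0 ∧ AnalyticAt ℂ B 0 ∧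
      ∀ {E : Type} (H : ℂ → ℂ → E), (∀ a b, H a b = H b a) → ∀ᶠ ζ in 𝓝 (0 : ℂ),
        H (extend f (sheet p 1 ((l + ζ ^ 2) • w))) (extend f (sheet p (-1) ((l + ζ ^ 2) • w))) =
          H (A ζ) (B ζ) := by
  have hD : AnalyticAt ℂ (fun z : ℂ => disc p (z • w)) l := by
    have : Differentiable ℂ (fun z : ℂ => disc p (z • w)) := by
      simp only [disc, Prod.smul_fst, Prod.smul_snd, smul_eq_mul]
      have := p.differentiable
      fun_prop
    exact this.analyticAt l
  obtain ⟨σ, hσ, hσ2⟩ := exists_analyticAt_sq_eq hD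
  have hcurve : ∀ τ : ℂ → ℂ, AnalyticAt ℂ τ 0 →
      AnalyticAt ℂ (fun ζ : ℂ => rootPoint ((l + ζ ^ 2) • w) (τ ζ)) 0 := fun τ hτ => by
    simp only [rootPoint, Prod.smul_fst, Prod.smul_snd, smul_eq_mul]
    refine AnalyticAt.prod ?_ (AnalyticAt.prod ?_ ?_) <;> fun_prop
  refine ⟨_, _, hf.analyticAt_comp (hcurve σ hσ) ?_, hf.analyticAt_comp (hcurve _ hσ.neg) ?_,
    fun {E} H hH => ?_⟩
  · filter_upwards [hσ2] with ζ hζ using rootPoint_mem hζ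
  · filter_upwards [hσ2] with ζ hζ
    exact rootPoint_mem (by simpa using hζ)
  · filter_upwards [hσ2] with ζ hζ
    exact symm_sheet_eq (G := fun a b => H (extend f a) (extend f b)) (fun a b => hH _ _) hζ

/-- The sum of `u ∘ f` over the two points of the surface above a point of `ℂ²`. -/
def fibreSum {p : Polynomial ℂ} (u : ℂ → ℝ) (f : surface p → ℂ) (w : ℂ × ℂ) : ℝ :=
  u (extend f (sheet p 1 w)) + u (extend f (sheet p (-1) w))

theorem IsHolomorphic.continuous_fibreSum {p : Polynomial ℂ} {f : surface p → ℂ}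
    (hf : IsHolomorphic f) {u : ℂ → ℝ} (hu : Continuous u) : Continuous (fibreSum u f) := by
  refine continuous_symm_sheet (G := fun a b => u (extend f a) + u (extend f b))
    (fun a b => add_comm _ _) ?_
  exact (hu.comp_continuousOn (hf.continuousOn.comp continuousOn_fst fun a ha => ha.1)).add
    (hu.comp_continuousOn (hf.continuousOn.comp continuousOn_snd fun a ha => ha.2))

/-- Fibre sums of subharmonic functions are subharmonic on lines through the origin. -/
theorem IsHolomorphic.support_fibreSum {p : Polynomial ℂ} {f : surface p → ℂ}
    (hf : IsHolomorphic f) {u : ℂ → ℝ} (hu : ∀ z, HolomorphicSupport u z) (w : ℂ × ℂ) (l : ℂ) :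
    HolomorphicSupport (fun ζ : ℂ => fibreSum u f ((l + ζ ^ 2) • w)) 0 := by
  obtain ⟨A, B, hA, hB, h⟩ := hf.exists_branches w l
  refine HolomorphicSupport.congr (((hu _).comp hA).add ((hu _).comp hB)) ?_
  exact (h (fun a b => u a + u b) fun a b => add_comm _ _).mono fun ζ hζ => hζ.symm

/-- The product of `f - c` over the two points of the surface above a point of `ℂ²`. -/
def fibreProd {p : Polynomial ℂ} (c : ℂ) (f : surface p → ℂ) (w : ℂ × ℂ) : ℂ :=
  (extend f (sheet p 1 w) - c) * (extend f (sheet p (-1) w) - c)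

theorem IsHolomorphic.continuous_fibreProd {p : Polynomial ℂ} {f : surface p → ℂ}
    (hf : IsHolomorphic f) (c : ℂ) : Continuous (fibreProd c f) := by
  refine continuous_symm_sheet (G := fun a b => (extend f a - c) * (extend f b - c))
    (fun a b => mul_comm _ _) ?_
  exact ((hf.continuousOn.comp continuousOn_fst fun a ha => ha.1).sub continuousOn_const).mul
    ((hf.continuousOn.comp continuousOn_snd fun a ha => ha.2).sub continuousOn_const)

theorem IsHolomorphic.differentiable_fibreProd {p : Polynomial ℂ} {f : surface p → ℂ}
    (hf : IsHolomorphic f) (c : ℂ) (w : ℂ × ℂ) :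
    Differentiable ℂ fun z : ℂ => fibreProd c f (z • w) := by
  refine differentiable_of_analyticAt_add_sq
    ((hf.continuous_fibreProd c).comp (by fun_prop)) fun l => ?_
  obtain ⟨A, B, hA, hB, h⟩ := hf.exists_branches w l
  refine AnalyticAt.congr (f := fun ζ => (A ζ - c) * (B ζ - c))
    ((hA.sub analyticAt_const).mul (hB.sub analyticAt_const)) ?_
  exact (h (fun a b => (a - c) * (b - c)) fun a b => mul_comm _ _).mono fun ζ hζ => hζ.symm

/-- A nonconstant function has a nonconstant fibre product: let `c` be a value other than the one
at a branch point of the projection. -/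
theorem exists_fibreProd_ne {p : Polynomial ℂ} {f : surface p → ℂ}
    (hfc : ¬ ∃ c : ℂ, ∀ q, f q = c) : ∃ c w w', fibreProd c f w ≠ fibreProd c f w' := by
  obtain ⟨x, hx⟩ := IsAlgClosed.exists_pow_nat_eq (p.eval 0) (n := 2) (by norm_num)
  have hb : (0 : ℂ) ^ 2 = disc p (2 * x, 0) := by
    simp only [disc, ← hx]; ring
  push Not at hfc
  obtain ⟨q, hq⟩ := hfc (f ⟨_, rootPoint_mem hb⟩)
  have hqs : (((q : ℂ × ℂ × ℂ).1 - (q : ℂ × ℂ × ℂ).2.1) / 2) ^ 2 = disc p (proj q) := by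
    have := q.2
    simp only [surface, Set.mem_ofPred_eq] at this
    simp only [disc, proj, ← this]; ring
  have hqr : rootPoint (proj q) (((q : ℂ × ℂ × ℂ).1 - (q : ℂ × ℂ × ℂ).2.1) / 2) = q := by
    simp only [rootPoint, proj]
    ext <;> simp <;> ring
  refine ⟨f q, (2 * x, 0), proj q, ?_⟩
  have hG : ∀ a b, (extend f a - f q) * (extend f b - f q) =
    (extend f b - f q) * (extend f a - f q) := fun a b => mul_comm _ _
  have h1 : fibreProd (f q) f (proj q) = 0 := by
    rw [fibreProd, symm_sheet_eq hG hqs, hqr, extend_apply, sub_self, zero_mul]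
  rw [h1, fibreProd, symm_sheet_eq hG hb, neg_zero, extend_of_mem f (rootPoint_mem hb)]
  exact mul_self_ne_zero.2 (sub_ne_zero.2 hq.symm)

/-! ### The density of the three-form in Hopf coordinates -/

/-- The Euclidean inner product on `ℂ² = ℝ⁴`. -/
def dot (w v : ℂ × ℂ) : ℝ :=
  w.1.re * v.1.re + w.1.im * v.1.im + (w.2.re * v.2.re + w.2.im * v.2.im)

/-- The imaginary part of the Hermitian product on `ℂ²`, a multiple of the Kähler form. -/
def omega (w v : ℂ × ℂ) : ℝ :=
  w.1.re * v.1.im - w.1.im * v.1.re + (w.2.re * v.2.im - w.2.im * v.2.re)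

theorem tau_eq (q : ℂ × ℂ × ℂ) : tau q = 1 / 2 * Real.log (dot (proj q) (proj q)) := by
  rw [tau, Real.log_sqrt (by positivity), ← Complex.normSq_eq_norm_sq, ← Complex.normSq_eq_norm_sq,
    Complex.normSq_apply, Complex.normSq_apply, dot]
  ring

theorem contDiff_dot_proj : ContDiff ℝ 2 fun q : ℂ × ℂ × ℂ => dot (proj q) (proj q) := by
  have h : ∀ q : ℂ × ℂ × ℂ, dot (proj q) (proj q) =
      Complex.reCLM (q.1 + q.2.1) * Complex.reCLM (q.1 + q.2.1) +
      Complex.imCLM (q.1 + q.2.1) * Complex.imCLM (q.1 + q.2.1) +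
      (Complex.reCLM q.2.2 * Complex.reCLM q.2.2 + Complex.imCLM q.2.2 * Complex.imCLM q.2.2) :=
    fun q => rfl
  simp only [h]
  fun_prop

theorem hasDerivAt_dot_line (q v : ℂ × ℂ × ℂ) :
    HasDerivAt (fun t : ℝ => dot (proj (q + t • v)) (proj (q + t • v)))
      (2 * dot (proj q) (proj v)) 0 := by
  have h : ∀ t : ℝ, dot (proj (q + t • v)) (proj (q + t • v)) =
      dot (proj q) (proj q) + t * (2 * dot (proj q) (proj v)) + t ^ 2 * dot (proj v) (proj v) := by
    intro t
    simp [dot, proj]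
    ring
  simp only [h]
  have := (((hasDerivAt_id (0 : ℝ)).mul_const (2 * dot (proj q) (proj v))).const_add
    (dot (proj q) (proj q))).add (((hasDerivAt_id (0 : ℝ)).pow 2).mul_const (dot (proj v) (proj v)))
  exact this.congr_deriv (by simp)

theorem hasDerivAt_omega_line (q v w : ℂ × ℂ × ℂ) :
    HasDerivAt (fun t : ℝ => omega (proj (q + t • v)) (proj w)) (omega (proj v) (proj w)) 0 := by
  have h : ∀ t : ℝ, omega (proj (q + t • v)) (proj w) =
      omega (proj q) (proj w) + t * omega (proj v) (proj w) := by
    intro t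
    simp [omega, proj]
    ring
  simp only [h]
  simpa using ((hasDerivAt_id (0 : ℝ)).mul_const (omega (proj v) (proj w))).const_add
    (omega (proj q) (proj w))

theorem contDiffAt_tau {q : ℂ × ℂ × ℂ} (hq : dot (proj q) (proj q) ≠ 0) : ContDiffAt ℝ 2 tau q := by
  have : tau = fun q => 1 / 2 * Real.log (dot (proj q) (proj q)) := funext tau_eq
  rw [this]
  exact contDiffAt_const.mul (contDiff_dot_proj.contDiffAt.log hq)

theorem fderiv_tau {q : ℂ × ℂ × ℂ} (hq : dot (proj q) (proj q) ≠ 0) (v : ℂ × ℂ × ℂ) :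
    fderiv ℝ tau q v = dot (proj q) (proj v) / dot (proj q) (proj q) := by
  have h1 := ((contDiffAt_tau hq).differentiableAt (by norm_num)).hasFDerivAt.hasLineDerivAt v
  have h2 : HasLineDerivAt ℝ tau (dot (proj q) (proj v) / dot (proj q) (proj q)) q v := by
    have h3 := ((hasDerivAt_dot_line q v).log (by simpa using hq)).const_mul (1 / 2)
    rw [HasLineDerivAt]
    simp only [tau_eq]
    convert! h3 using 1
    simp only [zero_smul, add_zero]
    ring
  exact HasDerivAt.unique h1 h2

theorem dc_tau {q : ℂ × ℂ × ℂ} (hq : dot (proj q) (proj q) ≠ 0) (v : ℂ × ℂ × ℂ) :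
    dc tau q v = omega (proj q) (proj v) / (4 * π * dot (proj q) (proj q)) := by
  have h : dc tau q v = -(1 / (4 * π)) * fderiv ℝ tau q (Complex.I • v) := rfl
  have h' : dot (proj q) (proj (Complex.I • v)) = - omega (proj q) (proj v) := by
    simp [dot, omega, proj]; ring
  rw [h, fderiv_tau hq, h']
  have := Real.pi_ne_zero
  field_simp

theorem differentiableAt_dc_tau {q : ℂ × ℂ × ℂ} (hq : dot (proj q) (proj q) ≠ 0) :
    DifferentiableAt ℝ (dc tau) q := by
  have h : DifferentiableAt ℝ (fderiv ℝ tau) q :=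
    ((contDiffAt_tau hq).fderiv_right (m := 1) (by norm_num)).differentiableAt (by norm_num)
  exact (h.clm_comp (differentiableAt_const
    (Complex.I • ContinuousLinearMap.id ℝ (ℂ × ℂ × ℂ)))).const_smul (-(1 / (4 * π)))

theorem fderiv_dc_tau {q : ℂ × ℂ × ℂ} (hq : dot (proj q) (proj q) ≠ 0) (v w : ℂ × ℂ × ℂ) :
    fderiv ℝ (dc tau) q v w =
      (omega (proj v) (proj w) * dot (proj q) (proj q) -
        2 * (omega (proj q) (proj w) * dot (proj q) (proj v))) /
          (4 * π * dot (proj q) (proj q) ^ 2) := by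
  have h1 : HasLineDerivAt ℝ (fun q => dc tau q w) (fderiv ℝ (dc tau) q v w) q v := by
    have := ((differentiableAt_dc_tau hq).hasFDerivAt.clm_apply
      (hasFDerivAt_const w q)).hasLineDerivAt v
    simpa using this
  have h2 : HasLineDerivAt ℝ (fun q => dc tau q w)
      ((omega (proj v) (proj w) * dot (proj q) (proj q) -
        2 * (omega (proj q) (proj w) * dot (proj q) (proj v))) /
          (4 * π * dot (proj q) (proj q) ^ 2)) q v := by
    have h3 := (hasDerivAt_omega_line q v w).div ((hasDerivAt_dot_line q v).const_mul (4 * π))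
      (by simpa using hq)
    have h4 : ∀ᶠ t : ℝ in 𝓝 0, dot (proj (q + t • v)) (proj (q + t • v)) ≠ 0 :=
      (hasDerivAt_dot_line q v).continuousAt.eventually_ne (by simpa using hq)
    rw [HasLineDerivAt]
    refine HasDerivAt.congr_of_eventuallyEq (f := fun t : ℝ => omega (proj (q + t • v)) (proj w) /
      (4 * π * dot (proj (q + t • v)) (proj (q + t • v)))) ?_ ?_
    · convert! h3 using 1
      simp only [zero_smul, add_zero]
      have := Real.pi_ne_zero
      field_simp
    · filter_upwards [h4] with t ht
      exact dc_tau ht w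
  exact HasDerivAt.unique h1 h2

/-- The three-form `η` on vectors that are tangent to the level set of `τ`. -/
theorem eta_of_dot_eq_zero {q v₁ v₂ v₃ : ℂ × ℂ × ℂ} (hq : dot (proj q) (proj q) ≠ 0)
    (h₁ : dot (proj q) (proj v₁) = 0) (h₂ : dot (proj q) (proj v₂) = 0)
    (h₃ : dot (proj q) (proj v₃) = 0) :
    eta q v₁ v₂ v₃ = (omega (proj q) (proj v₁) * omega (proj v₂) (proj v₃) -
      omega (proj q) (proj v₂) * omega (proj v₁) (proj v₃) +
      omega (proj q) (proj v₃) * omega (proj v₁) (proj v₂)) /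
        (8 * π ^ 2 * dot (proj q) (proj q) ^ 2) := by
  have anti : ∀ a b : ℂ × ℂ, omega a b = - omega b a := fun a b => by simp only [omega]; ring
  simp only [eta, levi, extD, dc_tau hq, fderiv_dc_tau hq, h₁, h₂, h₃, mul_zero, sub_zero]
  rw [anti (proj v₃) (proj v₂), anti (proj v₃) (proj v₁), anti (proj v₂) (proj v₁)]
  have := Real.pi_ne_zero
  field_simp
  ring

/-- The projection `π` as a continuous real-linear map. -/
def projCLM : (ℂ × ℂ × ℂ) →L[ℝ] ℂ × ℂ :=
  (ContinuousLinearMap.fst ℝ ℂ (ℂ × ℂ) +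
    (ContinuousLinearMap.fst ℝ ℂ ℂ).comp (ContinuousLinearMap.snd ℝ ℂ (ℂ × ℂ))).prod
  ((ContinuousLinearMap.snd ℝ ℂ ℂ).comp (ContinuousLinearMap.snd ℝ ℂ (ℂ × ℂ)))

theorem proj_sheet (p : Polynomial ℂ) (ε : ℤˣ) (w : ℂ × ℂ) : proj (sheet p ε w) = w := by
  simp only [proj, sheet]
  ext <;> simp

theorem differentiable_hopf (r : ℝ) : Differentiable ℝ (hopf r) := by
  have hc : Differentiable ℝ (fun x : ℝ => (x : ℂ)) := Complex.ofRealCLM.differentiable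
  unfold hopf
  have h1 : Differentiable ℝ (fun u : ℝ × ℝ × ℝ => ((r * Real.sin u.1 : ℝ) : ℂ)) :=
    hc.comp (by fun_prop)
  have h2 : Differentiable ℝ (fun u : ℝ × ℝ × ℝ => ((r * Real.cos u.1 : ℝ) : ℂ)) :=
    hc.comp (by fun_prop)
  have h3 : Differentiable ℝ (fun u : ℝ × ℝ × ℝ => (u.2.1 : ℂ)) := hc.comp (by fun_prop)
  have h4 : Differentiable ℝ (fun u : ℝ × ℝ × ℝ => (u.2.2 : ℂ)) := hc.comp (by fun_prop)
  exact (h1.mul ((h3.mul_const _).cexp)).prodMk (h2.mul ((h4.mul_const _).cexp))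

theorem proj_fderiv_param {p : Polynomial ℂ} {ε : ℤˣ} {r : ℝ} {u : ℝ × ℝ × ℝ}
    (h : DifferentiableAt ℝ (param p ε r) u) (e : ℝ × ℝ × ℝ) :
    proj (fderiv ℝ (param p ε r) u e) = fderiv ℝ (hopf r) u e := by
  have h1 := (projCLM.hasFDerivAt (x := param p ε r u)).comp u h.hasFDerivAt
  have h2 : (projCLM ∘ param p ε r) = hopf r := by
    ext1 x; exact proj_sheet p ε _
  rw [h2] at h1
  rw [h1.fderiv]
  rfl

theorem fderiv_hopf_fst (r : ℝ) (u : ℝ × ℝ × ℝ) : fderiv ℝ (hopf r) u (1, 0, 0) =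
    (((r * Real.cos u.1 : ℝ) : ℂ) * Complex.exp ((u.2.1 : ℂ) * Complex.I),
      ((-(r * Real.sin u.1) : ℝ) : ℂ) * Complex.exp ((u.2.2 : ℂ) * Complex.I)) := by
  have h1 := (differentiable_hopf r u).hasFDerivAt.hasLineDerivAt (1, 0, 0)
  refine HasDerivAt.unique h1 ?_
  have hs : HasDerivAt (fun t : ℝ => r * Real.sin (u.1 + t)) (r * Real.cos u.1) 0 := by
    simpa using (((hasDerivAt_id (0 : ℝ)).const_add u.1).sin).const_mul r
  have hc : HasDerivAt (fun t : ℝ => r * Real.cos (u.1 + t)) (-(r * Real.sin u.1)) 0 := by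
    simpa using (((hasDerivAt_id (0 : ℝ)).const_add u.1).cos).const_mul r
  have := (hs.ofReal_comp.mul_const (Complex.exp ((u.2.1 : ℂ) * Complex.I))).prodMk
    (hc.ofReal_comp.mul_const (Complex.exp ((u.2.2 : ℂ) * Complex.I)))
  simpa [hopf] using this

theorem hasDerivAt_exp_line (a : ℝ) :
    HasDerivAt (fun t : ℝ => Complex.exp (((a + t : ℝ) : ℂ) * Complex.I))
    (Complex.I * Complex.exp ((a : ℂ) * Complex.I)) 0 := by
  have h := ((((hasDerivAt_id (0 : ℝ)).const_add a).ofReal_comp).mul_const Complex.I).cexp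
  simpa [mul_comm] using h

theorem fderiv_hopf_snd (r : ℝ) (u : ℝ × ℝ × ℝ) : fderiv ℝ (hopf r) u (0, 1, 0) =
    (((r * Real.sin u.1 : ℝ) : ℂ) * (Complex.I * Complex.exp ((u.2.1 : ℂ) * Complex.I)), 0) := by
  have h1 := (differentiable_hopf r u).hasFDerivAt.hasLineDerivAt (0, 1, 0)
  refine HasDerivAt.unique h1 ?_
  have := ((hasDerivAt_exp_line u.2.1).const_mul ((r * Real.sin u.1 : ℝ) : ℂ)).prodMk
    (hasDerivAt_const (0 : ℝ) (((r * Real.cos u.1 : ℝ) : ℂ) *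
      Complex.exp ((u.2.2 : ℂ) * Complex.I)))
  simpa [hopf] using this

theorem fderiv_hopf_trd (r : ℝ) (u : ℝ × ℝ × ℝ) : fderiv ℝ (hopf r) u (0, 0, 1) =
    (0, ((r * Real.cos u.1 : ℝ) : ℂ) * (Complex.I * Complex.exp ((u.2.2 : ℂ) * Complex.I))) := by
  have h1 := (differentiable_hopf r u).hasFDerivAt.hasLineDerivAt (0, 0, 1)
  refine HasDerivAt.unique h1 ?_
  have := (hasDerivAt_const (0 : ℝ) (((r * Real.sin u.1 : ℝ) : ℂ) *
    Complex.exp ((u.2.1 : ℂ) * Complex.I))).prodMk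
    ((hasDerivAt_exp_line u.2.2).const_mul ((r * Real.cos u.1 : ℝ) : ℂ))
  simpa [hopf] using this

/-- As `π` maps the parametrization to the Hopf coordinates, the density of `η` is the same on both
sheets and does not depend on the polynomial. -/
theorem etaDensity_of_differentiableAt {p : Polynomial ℂ} {ε : ℤˣ} {r : ℝ} (hr : 0 < r)
    {u : ℝ × ℝ × ℝ} (h : DifferentiableAt ℝ (param p ε r) u) :
    etaDensity p ε r u = Real.sin u.1 * Real.cos u.1 / (8 * π ^ 2) := by
  have hp : proj (param p ε r u) = hopf r u := proj_sheet p ε _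
  have e1 := (proj_fderiv_param h (1, 0, 0)).trans (fderiv_hopf_fst r u)
  have e2 := (proj_fderiv_param h (0, 1, 0)).trans (fderiv_hopf_snd r u)
  have e3 := (proj_fderiv_param h (0, 0, 1)).trans (fderiv_hopf_trd r u)
  have hN : dot (proj (param p ε r u)) (proj (param p ε r u)) = r ^ 2 := by
    rw [hp]
    simp only [dot, hopf, Complex.re_ofReal_mul, Complex.im_ofReal_mul,
      Complex.exp_ofReal_mul_I_re, Complex.exp_ofReal_mul_I_im]
    linear_combination r ^ 2 * Real.sin u.1 ^ 2 * Real.sin_sq_add_cos_sq u.2.1 +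
      r ^ 2 * Real.cos u.1 ^ 2 * Real.sin_sq_add_cos_sq u.2.2 +
      r ^ 2 * Real.sin_sq_add_cos_sq u.1
  have h₁ : dot (hopf r u) (((r * Real.cos u.1 : ℝ) : ℂ) * Complex.exp ((u.2.1 : ℂ) * Complex.I),
      ((-(r * Real.sin u.1) : ℝ) : ℂ) * Complex.exp ((u.2.2 : ℂ) * Complex.I)) = 0 := by
    simp only [dot, hopf, Complex.re_ofReal_mul, Complex.im_ofReal_mul,
      Complex.exp_ofReal_mul_I_re, Complex.exp_ofReal_mul_I_im]
    linear_combination r ^ 2 * Real.sin u.1 * Real.cos u.1 * (Real.sin_sq_add_cos_sq u.2.1 -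
      Real.sin_sq_add_cos_sq u.2.2)
  rw [etaDensity, eta_of_dot_eq_zero (by rw [hN]; positivity) (by rw [hp, e1, h₁])
    (by
      rw [hp, e2]
      simp [dot, hopf, -Complex.ofReal_mul, -Complex.ofReal_sin, -Complex.ofReal_cos,
        Complex.exp_ofReal_mul_I_re, Complex.exp_ofReal_mul_I_im]
      ring)
    (by
      rw [hp, e3]
      simp [dot, hopf, -Complex.ofReal_mul, -Complex.ofReal_sin, -Complex.ofReal_cos,
        Complex.exp_ofReal_mul_I_re, Complex.exp_ofReal_mul_I_im]
      ring), hN, hp, e1, e2, e3]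
  rw [div_eq_div_iff (by positivity) (by positivity)]
  have k1 := Real.sin_sq_add_cos_sq u.2.1
  have k2 := Real.sin_sq_add_cos_sq u.2.2
  have k3 := Real.sin_sq_add_cos_sq u.1
  simp only [omega, hopf, Complex.re_ofReal_mul, Complex.im_ofReal_mul, Complex.I_mul_re,
    Complex.I_mul_im, Complex.zero_re, Complex.zero_im,
      Complex.exp_ofReal_mul_I_re, Complex.exp_ofReal_mul_I_im]
  generalize Real.sin u.1 = s at *
  generalize Real.cos u.1 = c at *
  generalize Real.sin u.2.1 = sa at *
  generalize Real.cos u.2.1 = ca at *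
  generalize Real.sin u.2.2 = sb at *
  generalize Real.cos u.2.2 = cb at *
  linear_combination 8 * π ^ 2 * r ^ 4 * s * c *
    ((sb ^ 2 + cb ^ 2) * (s ^ 2 + c ^ 2) * k1 + (s ^ 2 + c ^ 2) * k2 + k3)

theorem differentiableAt_param {p : Polynomial ℂ} (ε : ℤˣ) {r : ℝ} {u : ℝ × ℝ × ℝ}
    (h : disc p (hopf r u) ∈ Complex.slitPlane) : DifferentiableAt ℝ (param p ε r) u := by
  have h1 : DifferentiableAt ℂ (sheet p ε) (hopf r u) := by
    have hd : DifferentiableAt ℂ (disc p) (hopf r u) := by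
      unfold disc
      have := p.differentiable
      fun_prop
    have := hd.cpow_const (c := (1 / 2 : ℂ)) h
    unfold disc at this
    unfold sheet
    fun_prop
  exact (h1.restrictScalars ℝ).comp u (differentiable_hopf r u)

theorem countable_sin_two_mul_eq (k : ℝ) : {a : ℝ | Real.sin (2 * a) = k}.Countable := by
  rcases Set.eq_empty_or_nonempty {a : ℝ | Real.sin (2 * a) = k} with h | ⟨b, hb⟩
  · rw [h]; exact Set.countable_empty
  · refine ((Set.countable_range (fun n : ℤ => n * π + b)).union
      (Set.countable_range (fun n : ℤ => ((2 * n + 1) * π - 2 * b) / 2))).mono fun a ha => ?_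
    obtain ⟨n, hn⟩ := Real.sin_eq_sin_iff.1 (ha.trans hb.symm).symm
    rcases hn with hn | hn
    · exact Or.inl ⟨n, by simp only; linarith⟩
    · exact Or.inr ⟨n, by simp only; linarith⟩

/-- The sheets are smooth at almost all points: for fixed `t` and `b`, the discriminant moves with
`a` on a circle of positive radius, which meets the real line in finitely many points. -/
theorem ae_disc_mem_slitPlane (p : Polynomial ℂ) {r : ℝ} (hr : 0 < r) :
    ∀ᵐ u ∂(volume.restrict hopfBox), disc p (hopf r u) ∈ Complex.slitPlane := by
  have hmeas : Measurable fun u => disc p (hopf r u) :=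
    ((continuous_disc p).comp (differentiable_hopf r).continuous).measurable
  have hbox : MeasurableSet hopfBox :=
    measurableSet_Ioo.prod (measurableSet_Ioo.prod measurableSet_Ioo)
  rw [ae_restrict_iff' hbox, ae_iff]
  have hset : MeasurableSet {u | ¬ (u ∈ hopfBox → disc p (hopf r u) ∈ Complex.slitPlane)} :=
    (hbox.imp (hmeas Complex.isOpen_slitPlane.measurableSet)).compl
  rw [Measure.volume_eq_prod, Measure.measure_prod_null hset]
  refine Eventually.of_forall fun t => ?_
  simp only [Pi.zero_apply]
  rw [Measure.volume_eq_prod, Measure.prod_apply_symm (measurable_prodMk_left hset)]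
  refine lintegral_eq_zero_of_ae_eq_zero (Eventually.of_forall fun b => ?_)
  simp only [Pi.zero_apply]
  by_cases ht : t ∈ Set.Ioo 0 (π / 2)
  · have hs : 0 < Real.sin t := Real.sin_pos_of_pos_of_lt_pi ht.1 (by linarith [ht.2, Real.pi_pos])
    refine Set.Countable.measure_zero ((countable_sin_two_mul_eq
      (4 * (p.eval (hopf r (t, 0, b)).2).im / (r * Real.sin t) ^ 2)).mono fun a ha => ?_) _
    simp only [Set.mem_preimage, Set.mem_ofPred_eq, Classical.not_imp] at ha
    have him : (disc p (hopf r (t, a, b))).im = 0 := by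
      by_contra hne
      exact ha.2 (Complex.mem_slitPlane_iff.2 (Or.inr hne))
    have e : (hopf r (t, a, b)).1 ^ 2 =
        (((r * Real.sin t) ^ 2 : ℝ) : ℂ) * Complex.exp (((2 * a : ℝ) : ℂ) * Complex.I) := by
      simp only [hopf]
      rw [mul_pow, ← Complex.exp_nat_mul]
      push_cast
      ring_nf
    have e2 : (hopf r (t, a, b)).2 = (hopf r (t, 0, b)).2 := rfl
    simp only [disc, e, e2, Complex.sub_im] at him
    rw [Complex.div_ofNat_im, Complex.im_ofReal_mul, Complex.exp_ofReal_mul_I_im] at him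
    simp only [Set.mem_ofPred_eq]
    rw [eq_div_iff (by positivity)]
    linarith
  · convert measure_empty (μ := (volume : Measure ℝ))
    ext a
    simp only [hopfBox, Set.mem_prod, Set.mem_preimage, Set.mem_ofPred_eq, ht, false_and,
      false_imp_iff, not_true_eq_false, Set.mem_empty_iff_false]

theorem ae_etaDensity (p : Polynomial ℂ) (ε : ℤˣ) {r : ℝ} (hr : 0 < r) :
    ∀ᵐ u ∂(volume.restrict hopfBox),
      etaDensity p ε r u = Real.sin u.1 * Real.cos u.1 / (8 * π ^ 2) := by
  filter_upwards [ae_disc_mem_slitPlane p hr] with u hu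
  exact etaDensity_of_differentiableAt hr (differentiableAt_param ε hu)

/-! ### Integration over spheres -/

/-- The density of `η` in Hopf coordinates on each of the two sheets. -/
def hopfWeight (u : ℝ × ℝ × ℝ) : ℝ := Real.sin u.1 * Real.cos u.1 / (8 * π ^ 2)

theorem continuous_hopfWeight : Continuous hopfWeight := by
  unfold hopfWeight; fun_prop

theorem measurableSet_hopfBox : MeasurableSet hopfBox :=
  measurableSet_Ioo.prod (measurableSet_Ioo.prod measurableSet_Ioo)

theorem hopfWeight_pos {u : ℝ × ℝ × ℝ} (hu : u ∈ hopfBox) : 0 < hopfWeight u := by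
  obtain ⟨⟨h1, h2⟩, -⟩ := hu
  have hs : 0 < Real.sin u.1 := Real.sin_pos_of_pos_of_lt_pi h1 (by linarith [Real.pi_pos])
  have hc : 0 < Real.cos u.1 := Real.cos_pos_of_mem_Ioo ⟨by linarith, h2⟩
  unfold hopfWeight
  positivity

theorem closure_hopfBox : closure hopfBox =
    Set.Icc 0 (π / 2) ×ˢ Set.Icc 0 (2 * π) ×ˢ Set.Icc 0 (2 * π) := by
  have := Real.pi_pos
  rw [hopfBox, closure_prod_eq, closure_prod_eq, closure_Ioo (by positivity),
    closure_Ioo (by positivity)]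

theorem isCompact_closure_hopfBox : IsCompact (closure hopfBox) := by
  rw [closure_hopfBox]
  exact isCompact_Icc.prod (isCompact_Icc.prod isCompact_Icc)

theorem integrableOn_hopfBox {W : ℝ × ℝ × ℝ → ℝ} (hW : Continuous W) : IntegrableOn W hopfBox :=
  (hW.continuousOn.integrableOn_compact isCompact_closure_hopfBox).mono_set subset_closure

theorem continuous_hopf (r : ℝ) : Continuous (hopf r) := (differentiable_hopf r).continuous

theorem integrableOn_mul_hopfWeight {V : ℂ × ℂ → ℝ} (hV : Continuous V) (r : ℝ) :
    IntegrableOn (fun u => V (hopf r u) * hopfWeight u) hopfBox :=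
  integrableOn_hopfBox ((hV.comp (continuous_hopf r)).mul continuous_hopfWeight)

theorem integral_Ioo_shift {G : ℝ → ℝ} (hG : Function.Periodic G (2 * π)) (θ : ℝ) :
    ∫ a in Set.Ioo 0 (2 * π), G (a + θ) = ∫ a in Set.Ioo 0 (2 * π), G a := by
  have h0 : (0 : ℝ) ≤ 2 * π := by positivity
  rw [← integral_Ioc_eq_integral_Ioo, ← integral_Ioc_eq_integral_Ioo,
    ← intervalIntegral.integral_of_le h0, ← intervalIntegral.integral_of_le h0,
    intervalIntegral.integral_comp_add_right, zero_add, add_comm (2 * π) θ,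
    hG.intervalIntegral_add_eq θ 0, zero_add]

theorem integral_hopfBox_eq {W : ℝ × ℝ × ℝ → ℝ} (hW : Continuous W) :
    ∫ u in hopfBox, W u = ∫ t in Set.Ioo 0 (π / 2), ∫ a in Set.Ioo 0 (2 * π),
      ∫ b in Set.Ioo 0 (2 * π), W (t, a, b) := by
  have h1 := integrableOn_hopfBox hW
  unfold hopfBox at *
  rw [Measure.volume_eq_prod, setIntegral_prod _ h1]
  refine integral_congr_ae (Eventually.of_forall fun t => ?_)
  simp only
  rw [Measure.volume_eq_prod, setIntegral_prod]
  have : Continuous fun x : ℝ × ℝ => W (t, x) := by fun_prop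
  exact (this.continuousOn.integrableOn_compact (isCompact_Icc.prod isCompact_Icc)).mono_set
    (Set.prod_mono Set.Ioo_subset_Icc_self Set.Ioo_subset_Icc_self)

theorem integral_hopfBox_shift {W : ℝ × ℝ × ℝ → ℝ} (hW : Continuous W)
    (h1 : ∀ t a b, W (t, a + 2 * π, b) = W (t, a, b))
    (h2 : ∀ t a b, W (t, a, b + 2 * π) = W (t, a, b)) (θ : ℝ) :
    ∫ u in hopfBox, W (u.1, u.2.1 + θ, u.2.2 + θ) = ∫ u in hopfBox, W u := by
  rw [integral_hopfBox_eq hW, integral_hopfBox_eq (by fun_prop)]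
  refine integral_congr_ae (Eventually.of_forall fun t => ?_)
  simp only
  rw [← integral_Ioo_shift (G := fun a => ∫ b in Set.Ioo 0 (2 * π), W (t, a, b))
    (fun a => by simp only [h1]) θ]
  refine integral_congr_ae (Eventually.of_forall fun a => ?_)
  exact integral_Ioo_shift (G := fun b => W (t, a + θ, b)) (fun b => h2 t (a + θ) b) θ

theorem exp_smul_hopf (r θ : ℝ) (u : ℝ × ℝ × ℝ) :
    Complex.exp (θ * Complex.I) • hopf r u = hopf r (u.1, u.2.1 + θ, u.2.2 + θ) := by
  simp only [hopf, Prod.smul_mk, smul_eq_mul, Complex.ofReal_add, add_mul, Complex.exp_add]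
  ext1 <;> simp only <;> ring

theorem ofReal_smul_hopf (r : ℝ) (u : ℝ × ℝ × ℝ) : (r : ℂ) • hopf 1 u = hopf r u := by
  simp only [hopf, Prod.smul_mk, smul_eq_mul]
  push_cast
  ext1 <;> simp only <;> ring

theorem circleMap_smul_hopf (r θ : ℝ) (u : ℝ × ℝ × ℝ) :
    circleMap 0 r θ • hopf 1 u = Complex.exp (θ * Complex.I) • hopf r u := by
  rw [circleMap_zero, mul_comm, mul_smul, ofReal_smul_hopf]

/-- Invariance of the spherical integral under the diagonal rotations of `ℂ²`. -/
theorem integral_exp_smul_hopf {V : ℂ × ℂ → ℝ} (hV : Continuous V) (r θ : ℝ) :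
    ∫ u in hopfBox, V (Complex.exp (θ * Complex.I) • hopf r u) * hopfWeight u =
      ∫ u in hopfBox, V (hopf r u) * hopfWeight u := by
  simp only [exp_smul_hopf]
  have hper : ∀ a : ℝ, Complex.exp (((a + 2 * π : ℝ) : ℂ) * Complex.I) =
      Complex.exp ((a : ℂ) * Complex.I) := fun a => by
    push_cast
    rw [add_mul, Complex.exp_add, Complex.exp_two_pi_mul_I, mul_one]
  refine integral_hopfBox_shift (W := fun u => V (hopf r u) * hopfWeight u)
    ((hV.comp (continuous_hopf r)).mul continuous_hopfWeight) (fun t a b => ?_)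
    (fun t a b => ?_) θ <;> simp only [hopf, hper, hopfWeight]

theorem continuous_circleAverage_hopf {V : ℂ × ℂ → ℝ} (hV : Continuous V) (r : ℝ) :
    Continuous fun u => circleAverage (fun z : ℂ => V (z • hopf 1 u)) 0 r := by
  unfold circleAverage
  refine Continuous.const_smul (α := ℝ) (M := ℝ)
    (intervalIntegral.continuous_parametric_intervalIntegral_of_continuous'
    (μ := volume) (f := fun u θ => V (circleMap 0 r θ • hopf 1 u)) ?_ _ _) _
  have := continuous_hopf 1
  have := continuous_circleMap 0 r
  simp only [Function.uncurry_def]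
  fun_prop

/-- The mean over the sphere `r S³` is the mean over the complex lines through the origin of the
means over circles of radius `r`. -/
theorem integral_circleAverage_hopf {V : ℂ × ℂ → ℝ} (hV : Continuous V) (r : ℝ) :
    ∫ u in hopfBox, circleAverage (fun z : ℂ => V (z • hopf 1 u)) 0 r * hopfWeight u =
      ∫ u in hopfBox, V (hopf r u) * hopfWeight u := by
  have h0 : (0 : ℝ) ≤ 2 * π := by positivity
  have hc : Continuous fun x : (ℝ × ℝ × ℝ) × ℝ =>
      V (Complex.exp (x.2 * Complex.I) • hopf r x.1) * hopfWeight x.1 := by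
    have := continuous_hopf r
    have := continuous_hopfWeight
    fun_prop
  have hint : Integrable (Function.uncurry fun (u : ℝ × ℝ × ℝ) (θ : ℝ) =>
      V (Complex.exp (θ * Complex.I) • hopf r u) * hopfWeight u)
      ((volume.restrict hopfBox).prod (volume.restrict (Set.Ioc 0 (2 * π)))) := by
    rw [Measure.prod_restrict]
    exact (hc.continuousOn.integrableOn_compact
      (isCompact_closure_hopfBox.prod isCompact_Icc)).mono_set
      (Set.prod_mono subset_closure Set.Ioc_subset_Icc_self)
  have h1 := integral_integral_swap hint
  simp only [integral_exp_smul_hopf hV, integral_const, smul_eq_mul] at h1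
  have h2 : ∀ u, circleAverage (fun z : ℂ => V (z • hopf 1 u)) 0 r * hopfWeight u =
      (2 * π)⁻¹ * ∫ θ in Set.Ioc 0 (2 * π),
        V (Complex.exp (θ * Complex.I) • hopf r u) * hopfWeight u := fun u => by
    rw [circleAverage, intervalIntegral.integral_of_le h0, smul_eq_mul, mul_assoc,
      ← integral_mul_const]
    simp only [circleMap_smul_hopf]
  simp only [h2]
  rw [integral_const_mul, h1]
  have := Real.pi_pos
  rw [measureReal_def, Measure.restrict_apply_univ, Real.volume_Ioc, sub_zero,
    ENNReal.toReal_ofReal h0]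
  field_simp

/-- The mean value inequality on spheres follows from the one on complex lines. -/
theorem mul_integral_hopfWeight_le {V : ℂ × ℂ → ℝ} (hV : Continuous V) {r : ℝ}
    (h : ∀ w : ℂ × ℂ, V 0 ≤ circleAverage (fun z : ℂ => V (z • w)) 0 r) :
    V 0 * ∫ u in hopfBox, hopfWeight u ≤ ∫ u in hopfBox, V (hopf r u) * hopfWeight u := by
  rw [← integral_circleAverage_hopf hV r, ← integral_const_mul]
  refine setIntegral_mono_on (integrableOn_hopfBox (continuous_const.mul continuous_hopfWeight))
    (integrableOn_hopfBox ((continuous_circleAverage_hopf hV r).mul continuous_hopfWeight))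
    measurableSet_hopfBox fun u hu => ?_
  exact mul_le_mul_of_nonneg_right (h _) (hopfWeight_pos hu).le

/-! ### The characteristic -/

theorem IsHolomorphic.comp {p : Polynomial ℂ} {f : surface p → ℂ} (hf : IsHolomorphic f)
    {g : ℂ → ℂ} (hg : Differentiable ℂ g) : IsHolomorphic fun q => g (f q) := by
  intro q
  obtain ⟨U, F, hU, hq, hF, h⟩ := hf q
  exact ⟨U, fun x => g (F x), hU, hq, hg.comp_differentiableOn hF, fun s hs =>
    congrArg g (h s hs)⟩

theorem IsHolomorphic.continuous {p : Polynomial ℂ} {f : surface p → ℂ} (hf : IsHolomorphic f) :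
    Continuous f := by
  have := continuousOn_iff_continuous_domRestrict.1 hf.continuousOn
  refine this.congr fun q => extend_apply f q

theorem fibreSum_comp {p : Polynomial ℂ} (f : surface p → ℂ) (g : ℂ → ℂ) (u : ℂ → ℝ) (w : ℂ × ℂ) :
    fibreSum u (fun q => g (f q)) w = fibreSum (fun z => u (g z)) f w := by
  simp only [fibreSum, extend_of_mem _ (sheet_mem p _ w)]

theorem measurable_param (p : Polynomial ℂ) (ε : ℤˣ) (r : ℝ) : Measurable (param p ε r) := by
  have hs : Measurable (sheet p ε) := by
    have := p.continuous.measurable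
    unfold sheet
    have h1 : Measurable fun w : ℂ × ℂ => (w.1 ^ 2 / 4 - p.eval w.2) ^ (1 / 2 : ℂ) :=
      Measurable.pow_const
        ((measurable_fst.pow_const 2).div_const 4 |>.sub (this.comp measurable_snd)) _
    fun_prop
  exact hs.comp (continuous_hopf r).measurable

theorem continuous_posLog_norm_sq : Continuous fun z : ℂ => log⁺ (‖z‖ ^ 2) :=
  continuous_posLog.comp (continuous_norm.pow 2)

/-- The Griffiths–King characteristic as an integral over the sphere in `ℂ²`. -/
theorem charGK_eq {p : Polynomial ℂ} {f : surface p → ℂ} (hf : IsHolomorphic f) {r : ℝ}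
    (hr : 0 < r) : charGK f r =
      ∫ u in hopfBox, fibreSum (fun z => log⁺ (‖z‖ ^ 2)) f (hopf r u) * hopfWeight u := by
  have hsheet : ∀ ε : ℤˣ, ∀ w, extend f (sheet p ε w) = f ⟨sheet p ε w, sheet_mem p ε w⟩ :=
    fun ε w => extend_of_mem f _
  have hle : ∀ (ε : ℤˣ) w, log⁺ (‖extend f (sheet p ε w)‖ ^ 2) ≤
      fibreSum (fun z => log⁺ (‖z‖ ^ 2)) f w := fun ε w => by
    have h1 : 0 ≤ log⁺ (‖extend f (sheet p 1 w)‖ ^ 2) := posLog_nonneg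
    have h2 : 0 ≤ log⁺ (‖extend f (sheet p (-1) w)‖ ^ 2) := posLog_nonneg
    rcases Int.units_eq_one_or ε with rfl | rfl <;> simp only [fibreSum] <;> linarith
  have hint : ∀ ε : ℤˣ, IntegrableOn
      (fun u => log⁺ (‖extend f (sheet p ε (hopf r u))‖ ^ 2) * hopfWeight u) hopfBox := fun ε => by
    refine Integrable.mono' (integrableOn_mul_hopfWeight (hf.continuous_fibreSum
      continuous_posLog_norm_sq) r) ?_ ?_
    · simp only [hsheet]
      refine (Measurable.mul ?_ continuous_hopfWeight.measurable).aestronglyMeasurable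
      exact (continuous_posLog_norm_sq.comp hf.continuous).measurable.comp
        ((measurable_param p ε r).subtype_mk)
    · refine (ae_restrict_mem measurableSet_hopfBox).mono fun u hu => ?_
      rw [Real.norm_of_nonneg (mul_nonneg posLog_nonneg (hopfWeight_pos hu).le)]
      exact mul_le_mul_of_nonneg_right (hle ε _) (hopfWeight_pos hu).le
  have hcongr : ∀ ε : ℤˣ, ∫ u in hopfBox,
      log⁺ (‖f ⟨param p ε r u, sheet_mem p ε (hopf r u)⟩‖ ^ 2) * etaDensity p ε r u =
      ∫ u in hopfBox, log⁺ (‖extend f (sheet p ε (hopf r u))‖ ^ 2) * hopfWeight u := fun ε => by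
    refine integral_congr_ae ((ae_etaDensity p ε hr).mono fun u hu => ?_)
    simp only [hu, hsheet, hopfWeight, param]
  simp only [charGK, boundaryIntegral, hcongr, fibreSum, add_mul]
  rw [integral_add (hint 1) (hint (-1)), show (Finset.univ : Finset ℤˣ) = {1, -1} from rfl,
    Finset.sum_pair (by decide)]

/-- Comparison of the characteristics of `g ∘ f` and `f`. -/
theorem exists_mul_charGK_sub_le {p : Polynomial ℂ} {f : surface p → ℂ} (hf : IsHolomorphic f)
    {g : ℂ → ℂ} (hg : IsTranscendentalEntire g) (K : ℝ) :
    ∃ C : ℝ, ∀ r : ℝ, 0 < r → K * charGK f r - C ≤ charGK (fun q => g (f q)) r := by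
  obtain ⟨h, hc, hs, hle⟩ := hg.exists_minorant K
  have hV := hf.continuous_fibreSum hc
  refine ⟨-(2 * (fibreSum h f 0 * ∫ u in hopfBox, hopfWeight u)), fun r hr => ?_⟩
  have h1 : fibreSum h f 0 * ∫ u in hopfBox, hopfWeight u ≤
      ∫ u in hopfBox, fibreSum h f (hopf r u) * hopfWeight u := by
    refine mul_integral_hopfWeight_le hV fun w => ?_
    have := le_circleAverage (U := fun z : ℂ => fibreSum h f (z • w)) (hV.comp (by fun_prop))
      (fun l => hf.support_fibreSum hs w l) hr
    simpa using this
  have hU := hf.continuous_fibreSum continuous_posLog_norm_sq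
  have hUg := (hf.comp hg.1).continuous_fibreSum continuous_posLog_norm_sq
  have i1 := integrableOn_mul_hopfWeight hU r
  have i2 := integrableOn_mul_hopfWeight hV r
  have i3 := integrableOn_mul_hopfWeight hUg r
  have hpt : ∀ z, K * log⁺ (‖z‖ ^ 2) + 2 * h z ≤ log⁺ (‖g z‖ ^ 2) := fun z => by
    have := hle z
    rw [posLog_pow, posLog_pow]
    push_cast
    linarith
  have h2 : K * charGK f r + 2 * ∫ u in hopfBox, fibreSum h f (hopf r u) * hopfWeight u ≤
      charGK (fun q => g (f q)) r := by
    rw [charGK_eq hf hr, charGK_eq (hf.comp hg.1) hr, ← integral_const_mul, ← integral_const_mul,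
      ← integral_add (i1.const_mul K) (i2.const_mul 2)]
    refine setIntegral_mono_on ((i1.const_mul K).add (i2.const_mul 2)) i3 measurableSet_hopfBox
      fun u hu => ?_
    have hw := (hopfWeight_pos hu).le
    rw [fibreSum_comp, ← mul_assoc, ← mul_assoc, ← add_mul]
    refine mul_le_mul_of_nonneg_right ?_ hw
    have ha := hpt (extend f (sheet p 1 (hopf r u)))
    have hb := hpt (extend f (sheet p (-1) (hopf r u)))
    simp only [fibreSum]
    linarith
  linarith

/-- On a complex line on which the circular means are bounded along a sequence of radii tending to
infinity, the fibre product is constant. -/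
theorem IsHolomorphic.fibreProd_eq_of_frequently {p : Polynomial ℂ} {f : surface p → ℂ}
    (hf : IsHolomorphic f) (c : ℂ) (w : ℂ × ℂ) {ρ : ℕ → ℝ} (hρ : Tendsto ρ atTop atTop) {B : ℝ}
    (hB : ∃ᶠ n in atTop,
      circleAverage (fun z : ℂ => fibreSum (fun z => log⁺ (‖z‖ ^ 2)) f (z • w)) 0 (ρ n) ≤ B)
    (z : ℂ) : fibreProd c f (z • w) = fibreProd c f 0 := by
  have hU := hf.continuous_fibreSum continuous_posLog_norm_sq
  have hsupp : ∀ z : ℂ, HolomorphicSupport (fun z : ℂ => log⁺ (‖z‖ ^ 2)) z := fun z => by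
    refine (HolomorphicSupport.posLog_norm (F := fun z => z ^ 2) (by fun_prop)).congr
      (Eventually.of_forall fun y => ?_)
    simp only [norm_pow]
  have hbound : ∀ z : ℂ, fibreSum (fun z => log⁺ (‖z‖ ^ 2)) f (z • w) ≤ 3 * B := fun z => by
    obtain ⟨n, hn, hzn, hn0⟩ := (hB.and_eventually
      ((hρ.eventually_ge_atTop (2 * ‖z‖)).and (hρ.eventually_gt_atTop 0))).exists
    have := le_three_mul_circleAverage
      (U := fun z : ℂ => fibreSum (fun z => log⁺ (‖z‖ ^ 2)) f (z • w)) (hU.comp (by fun_prop))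
      (fun l => hf.support_fibreSum hsupp w l) (fun z => add_nonneg posLog_nonneg posLog_nonneg)
      hn0 hzn
    linarith
  have hnorm : ∀ a : ℂ, log⁺ (‖a‖ ^ 2) ≤ 3 * B → ‖a‖ ≤ Real.exp (3 * B) := fun a ha => by
    have h1 : log⁺ ‖a‖ ≤ 3 * B := by
      rw [posLog_pow] at ha
      push_cast at ha
      have : 0 ≤ log⁺ ‖a‖ := posLog_nonneg
      linarith
    have h2 : ‖a‖ ≤ Real.exp (log⁺ ‖a‖) := by
      rw [posLog_eq_log_max_one (norm_nonneg _), Real.exp_log (by positivity)]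
      exact le_max_right _ _
    exact h2.trans (Real.exp_le_exp.2 h1)
  have hbdd : Bornology.IsBounded (Set.range fun z : ℂ => fibreProd c f (z • w)) := by
    refine (isBounded_iff_forall_norm_le).2
      ⟨(Real.exp (3 * B) + ‖c‖) * (Real.exp (3 * B) + ‖c‖), ?_⟩
    rintro _ ⟨z, rfl⟩
    have h1 := hbound z
    have ha : 0 ≤ log⁺ (‖extend f (sheet p 1 (z • w))‖ ^ 2) := posLog_nonneg
    have hb : 0 ≤ log⁺ (‖extend f (sheet p (-1) (z • w))‖ ^ 2) := posLog_nonneg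
    simp only [fibreSum] at h1
    simp only [fibreProd, norm_mul]
    have h2 := hnorm (extend f (sheet p 1 (z • w))) (by linarith)
    have h3 := hnorm (extend f (sheet p (-1) (z • w))) (by linarith)
    gcongr
    · exact (norm_sub_le _ _).trans (by linarith)
    · exact (norm_sub_le _ _).trans (by linarith)
  simpa using (hf.differentiable_fibreProd c w).apply_eq_apply_of_bounded hbdd z 0

/-- The Hopf coordinates reach every point of `ℂ²`. -/
theorem exists_hopf_eq (w : ℂ × ℂ) : ∃ r : ℝ, ∃ u ∈ closure hopfBox, hopf r u = w := by
  have harg : ∀ a : ℂ, ∃ α ∈ Set.Icc 0 (2 * π),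
      (‖a‖ : ℂ) * Complex.exp ((α : ℂ) * Complex.I) = a := by
    intro a
    have h1 := Complex.neg_pi_lt_arg a
    have h2 := Complex.arg_le_pi a
    rcases le_or_gt 0 (Complex.arg a) with h | h
    · exact ⟨Complex.arg a, ⟨h, by linarith⟩, Complex.norm_mul_exp_arg_mul_I a⟩
    · refine ⟨Complex.arg a + 2 * π, ⟨by linarith, by linarith⟩, ?_⟩
      push_cast
      rw [add_mul, Complex.exp_add, Complex.exp_two_pi_mul_I, mul_one,
        Complex.norm_mul_exp_arg_mul_I]
  obtain ⟨α, hα, h1⟩ := harg w.1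
  obtain ⟨β, hβ, h2⟩ := harg w.2
  set z : ℂ := ⟨‖w.2‖, ‖w.1‖⟩ with hz
  refine ⟨‖z‖, (Complex.arg z, α, β), ?_, ?_⟩
  · rw [closure_hopfBox]
    refine ⟨⟨Complex.arg_nonneg_iff.2 (norm_nonneg _), ?_⟩, hα, hβ⟩
    exact (abs_le.1 (Complex.abs_arg_le_pi_div_two_iff.2 (norm_nonneg w.2))).2
  · have h3 := Complex.norm_mul_cos_arg z
    have h4 := Complex.norm_mul_sin_arg z
    simp only [hopf, h3, h4]
    ext1 <;> simp only [hz, h1, h2]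

/-- The characteristic of a nonconstant holomorphic function is unbounded. -/
theorem tendsto_charGK_atTop {p : Polynomial ℂ} {f : surface p → ℂ} (hf : IsHolomorphic f)
    (hfc : ¬ ∃ c : ℂ, ∀ q, f q = c) : Tendsto (charGK f) atTop atTop := by
  obtain ⟨c, w₁, w₂, hne⟩ := exists_fibreProd_ne hfc
  by_contra hcon
  rw [Filter.tendsto_atTop] at hcon
  push Not at hcon
  obtain ⟨M, hM⟩ := hcon
  obtain ⟨ρ, hρ, hρM⟩ := exists_seq_forall_of_frequently (hM.and_eventually (eventually_gt_atTop 0))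
  have hU := hf.continuous_fibreSum continuous_posLog_norm_sq
  set U := fibreSum (fun z => log⁺ (‖z‖ ^ 2)) f
  have hU0 : ∀ w, 0 ≤ U w := fun w => add_nonneg posLog_nonneg posLog_nonneg
  let A : ℕ → ℝ × ℝ × ℝ → ℝ := fun n u => circleAverage (fun z : ℂ => U (z • hopf 1 u)) 0 (ρ n)
  have hA0 : ∀ n u, 0 ≤ A n u := fun n u => circleAverage_nonneg_of_nonneg fun z _ => hU0 _
  have hAc : ∀ n, Continuous (A n) := fun n => continuous_circleAverage_hopf hU _
  have hlint : ∀ n, ∫⁻ u in hopfBox, ENNReal.ofReal (A n u * hopfWeight u) ≤ ENNReal.ofReal M := by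
    intro n
    rw [← ofReal_integral_eq_lintegral_ofReal (f := fun u => A n u * hopfWeight u)
      (integrableOn_hopfBox ((hAc n).mul continuous_hopfWeight))
      ((ae_restrict_mem measurableSet_hopfBox).mono fun u hu =>
        mul_nonneg (hA0 n u) (hopfWeight_pos hu).le)]
    refine ENNReal.ofReal_le_ofReal ?_
    rw [integral_circleAverage_hopf hU, ← charGK_eq hf (hρM n).2]
    exact (hρM n).1.le
  have hmeas : ∀ n, Measurable fun u => ENNReal.ofReal (A n u * hopfWeight u) := fun n =>
    ((hAc n).mul continuous_hopfWeight).measurable.ennreal_ofReal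
  -- By Fatou's lemma the lower limit of the circular means is finite on almost every line.
  have hfatou : ∫⁻ u in hopfBox, liminf (fun n => ENNReal.ofReal (A n u * hopfWeight u)) atTop
      ≠ ⊤ := by
    refine ne_top_of_le_ne_top (b := ENNReal.ofReal M) ENNReal.ofReal_ne_top
      ((lintegral_liminf_le hmeas).trans ?_)
    exact liminf_le_of_frequently_le' (Frequently.of_forall hlint)
  have hae := ae_lt_top (.liminf hmeas) hfatou
  have hline : ∀ᵐ u ∂(volume.restrict hopfBox), ∀ z : ℂ,
      fibreProd c f (z • hopf 1 u) = fibreProd c f 0 := by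
    filter_upwards [hae, ae_restrict_mem measurableSet_hopfBox] with u hu hub z
    obtain ⟨B, hB1, hB2⟩ := ENNReal.lt_iff_exists_nnreal_btwn.1 hu
    refine hf.fibreProd_eq_of_frequently c (hopf 1 u) hρ (B := B / hopfWeight u) ?_ z
    refine (frequently_lt_of_liminf_lt (by isBoundedDefault) hB1).mono fun n hn => ?_
    rw [le_div_iff₀ (hopfWeight_pos hub)]
    have := (ENNReal.ofReal_lt_iff_lt_toReal (mul_nonneg (hA0 n u) (hopfWeight_pos hub).le)
      ENNReal.coe_ne_top).1 hn
    exact this.le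
  have hS := hf.continuous_fibreProd c
  have hall : ∀ w, fibreProd c f w = fibreProd c f 0 := by
    intro w
    obtain ⟨r, u, hu, rfl⟩ := exists_hopf_eq w
    have hbox : Set.EqOn (fun u => fibreProd c f (hopf r u))
        (fun _ => fibreProd c f 0) hopfBox := by
      refine Measure.eqOn_open_of_ae_eq (μ := volume) (hline.mono fun u hu => ?_)
        (isOpen_Ioo.prod (isOpen_Ioo.prod isOpen_Ioo))
        (hS.comp (continuous_hopf r)).continuousOn continuousOn_const
      simpa only [ofReal_smul_hopf] using hu (r : ℂ)
    exact hbox.closure (hS.comp (continuous_hopf r)) continuous_const hu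
  exact hne ((hall w₁).trans (hall w₂).symm)

end Danielewski

end

theorem proposition3p6 (p : Polynomial ℂ) (hp : 0 < p.natDegree)
    (hsimple : ∀ w : ℂ, p.eval w = 0 → p.derivative.eval w ≠ 0)
    (f : Danielewski.surface p → ℂ) (hf : Danielewski.IsHolomorphic f)
    (hfc : ¬ ∃ c : ℂ, ∀ q, f q = c)
    (g : ℂ → ℂ) (hg : Danielewski.IsTranscendentalEntire g) :
    Filter.Tendsto
        (fun r : ℝ => Danielewski.charGK (fun q => g (f q)) r / Danielewski.charGK f r)
        Filter.atTop Filter.atTop ∧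
      Filter.Tendsto
        (fun r : ℝ => Danielewski.charAR (fun q => g (f q)) r / Danielewski.charAR f r)
        Filter.atTop Filter.atTop := by
  have h : Filter.Tendsto
      (fun r : ℝ => Danielewski.charGK (fun q => g (f q)) r / Danielewski.charGK f r)
      Filter.atTop Filter.atTop := by
    refine Filter.tendsto_atTop.2 fun K => ?_
    obtain ⟨C, hC⟩ := Danielewski.exists_mul_charGK_sub_le hf hg (K + 1)
    have hT := Danielewski.tendsto_charGK_atTop hf hfc
    filter_upwards [hT.eventually_ge_atTop C, hT.eventually_gt_atTop 0,
      Filter.eventually_gt_atTop 0] with r h1 h2 h3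
    rw [le_div_iff₀ h2]
    linarith [hC r h3]
  refine ⟨h, h.congr' ?_⟩
  filter_upwards [Filter.eventually_gt_atTop 0] with r hr
  rw [Danielewski.charAR, Danielewski.charAR, div_div_div_cancel_right₀ (by positivity)]
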